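/- **Setting.** Fix a signature $\Sigma$ (symbols $s$ with arities) and an infinite set of variables with a distinguished root variable $v_\top$. Write $t|_p$ for the subterm of a finite term $t$ at a path $p\in\mathbb N^*$ (possibly undefined). A path equivalence class (PEC) is a finite set $c$ of paths; $t$ satisfies $c$ if all $t|_p$, $p\in c$, are defined and equal. A path constraint set $C$ is a finite set of PECs, satisfied if all its members are, and consistent if some term satisfies it. An acyclic ECTA is a node $n=\mathsf U(\bar e)$ with finitely many transitions; a transition is $s(n^0,\dots,n^{k-1})\{C\}$ with $k=\mathrm{arity}(s)$, or the empty transition. Its denotation is $[\![\mathsf U(\bar e)]\!]=\bigcup_i[\![e^i]\!]$, $[\![s(\bar n)\{C\}]\!]=\{s(\bar t): t^i\in[\![n^i]\!],\ s(\bar t)\text{ satisfies }C\}$; the empty transition denotes $\emptyset$. The intersection $n_1\sqcap n_2$ intersects all pairs of transitions: two transitions with the same symbol and with consistent $C_1\cup C_2$ (where overlapping PECs are merged) give the transition with this symbol, childwise intersections and constraint $C_1\cup C_2$; all other pairs give the empty transition. The result is normalized: transitions with an empty child are deleted, recursively. A p-term $\tau$ is a variable, an application $s(\bar\tau)$, or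 a u-node $\langle n,\Phi\rangle$, with $\Phi$ a finite set of fragments $(c\mapsto v)$; $v$ is a variable. A state $\sigma$ is a partial map from variables to p-terms; it is fully enumerated if all its u-nodes have $\Phi=\emptyset$; a variable is solved if no fragment of $\sigma$ mentions it. Let $\mathrm{project}(\Phi,i)$ consist of all $(\{p: i.p\in c\}\mapsto v)$ with $(c\mapsto v)\in\Phi$ and non-empty first component. With $\mathcal C[\cdot]$ ranging over one-hole contexts built from applications, the rules are: * *Choose*: if $\sigma(x)=\mathcal C[\langle n,\Phi\rangle]$, $x$ is solved, no $(\{\epsilon\}\mapsto v)$ is in $\Phi$, and $s(\bar n)\{C\}$ is a transition of $n$, put $\Psi=\{(c\mapsto v_c):c\in C\}\cup\Phi$ with distinct fresh variables $v_c$, and replace the u-node by $s(\langle n^0,\mathrm{project}(\Psi,0)\rangle,\dots,\langle n^{k-1},\mathrm{project}(\Psi,k-1)\rangle)$. This requires (i) that no PEC in $\Psi$ contains the empty path $\epsilon$, and (ii) that every path in $\Psi$ starts with an index $<\mathrm{arity}(s)$. * *Suspend-1*: if $\sigma(x)=\mathcal C[\langle n,\{\{\epsilon\}\mapsto x'\}\cup\Phi\rangle]$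 with $(\{\epsilon\}\mapsto x')\notin\Phi$ and $x'\notin\mathrm{dom}\,\sigma$, set $x\mapsto\mathcal C[x']$ and then $x'\mapsto\langle n,\Phi\rangle$. * *Suspend-2*: if $\sigma(x)$ is as before and $\sigma(x')=\langle n',\Phi'\rangle$, set $x\mapsto\mathcal C[x']$ and then $x'\mapsto\langle n\sqcap n',\Phi\cup\Phi'\rangle$. * *Subst*: if $\sigma(x_2)=x_1$, remove $x_2$ from the domain and replace $x_2$ by $x_1$ everywhere, also in fragments. For a total map $\rho$ from variables to terms, define inductively which terms $t$ a p-term denotes: $s(\bar\tau)$ denotes $s(\bar t)$ if each $\tau^i$ denotes $t^i$; $\langle n,\Phi\rangle$ denotes $t$ if $t\in[\![n]\!]$ and $t|_p=\rho(v)$ for all $(c\mapsto v)\in\Phi$, $p\in c$; a variable $x\in\mathrm{dom}\,\sigma$ denotes $t$ if $\sigma(x)$ denotes $t$ and $\rho(x)=t$. Then $[\![\sigma]\!]$ is the set of restrictions $\rho|_{\mathrm{dom}\,\sigma}$ of those total $\rho$ for which $\sigma(x)$ denotes $\rho(x)$ for every $x\in\mathrm{dom}\,\sigma$. **Theorem (Correctness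 of Enumeration).** Let $n$ be an acyclic ECTA none of whose transitions (at any depth) carries the trivial PEC $\{\epsilon\}$, and let $\sigma_0=[v_\top\mapsto\langle n,\emptyset\rangle]$. Then $$[\![n]\!]=\{\rho(v_\top)\;:\;\sigma_0\longrightarrow^*\sigma_\bullet,\ \sigma_\bullet\text{ fully enumerated},\ \rho\in[\![\sigma_\bullet]\!]\},$$ where $\longrightarrow$ is given by the four rules. If, moreover, every constraint path of $n$ is in range (whichever transitions are chosen below the transition that carries the constraint, following the path never asks for a child that does not exist), then the same equality holds for the rules with side condition (ii) omitted from *Choose*. -/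

import Mathlib

universe u v

namespace ECTA

/-- A signature: a set of function symbols, each with an arity. -/
structure Signature where
  Sym : Type u
  arity : Sym → ℕ

/-- Terms over a signature. -/
inductive Term (S : Signature.{u}) : Type u
  | mk (s : S.Sym) (ts : Fin (S.arity s) → Term S) : Term S

/-- Paths: finite sequences of natural numbers. -/
abbrev Path := List ℕ

/-- The subterm of `t` at a path, `none` when the path leaves the term. -/
def Term.at {S : Signature.{u}} : Term S → Path → Option (Term S)
  | t, [] => some t
  | .mk s ts, i :: p => if h : i < S.arity s then (ts ⟨i, h⟩).at p else none

/-- Path equivalence classes. -/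
abbrev PEC := Finset Path

/-- Path constraint sets. -/
abbrev PCS := Finset PEC

/-- `t` satisfies `c`: all paths of `c` lead to one and the same subterm of `t`. -/
def PEC.Sat {S : Signature.{u}} (c : PEC) (t : Term S) : Prop :=
  ∃ t' : Term S, ∀ p ∈ c, t.at p = some t'

def PCS.Sat {S : Signature.{u}} (C : PCS) (t : Term S) : Prop :=
  ∀ c ∈ C, PEC.Sat c t

def PCS.Consistent (S : Signature.{u}) (C : PCS) : Prop :=
  ∃ t : Term S, PCS.Sat C t

/-- Two members of `C` that share a path. -/
def PCS.Overlap (C : PCS) (c c' : PEC) : Prop :=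
  c ∈ C ∧ c' ∈ C ∧ ¬ Disjoint c c'

open Classical in
/-- Normalization of a set of classes: classes connected by a chain of overlaps are merged, so
that the resulting classes are pairwise disjoint. -/
noncomputable def PCS.merge (C : PCS) : PCS :=
  C.image fun c => (C.filter fun c' => Relation.ReflTransGen (PCS.Overlap C) c c').sup id

open Classical in
/-- The (normalized) union of two path constraint sets. -/
noncomputable def PCS.union (C₁ C₂ : PCS) : PCS := PCS.merge (C₁ ∪ C₂)

mutual
/-- Nodes of an acyclic ECTA. An ECTA is identified with its root node. -/
inductive Node (S : Signature.{u}) : Type u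
  | mk (es : List (Edge S)) : Node S
/-- Transitions: a symbol with one child node per argument and a path constraint set, or the
empty transition. -/
inductive Edge (S : Signature.{u}) : Type u
  | mk (s : S.Sym) (ch : Fin (S.arity s) → Node S) (C : PCS) : Edge S
  | bot : Edge S
end

def Node.edges {S : Signature.{u}} : Node S → List (Edge S)
  | .mk es => es

mutual
/-- Denotation of a node: the union of the denotations of its transitions. -/
def Node.den {S : Signature.{u}} : Node S → Set (Term S)
  | .mk es => Edge.denList es
/-- Denotation of a transition. -/
def Edge.den {S : Signature.{u}} : Edge S → Set (Term S)
  | .mk s ch C => {t | ∃ ts : Fin (S.arity s) → Term S,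
      t = .mk s ts ∧ (∀ i, ts i ∈ (ch i).den) ∧ PCS.Sat C (.mk s ts)}
  | .bot => ∅
def Edge.denList {S : Signature.{u}} : List (Edge S) → Set (Term S)
  | [] => ∅
  | e :: es => e.den ∪ Edge.denList es
end

open Classical in
mutual
/-- Intersection of nodes, before normalization: all pairs of transitions are intersected. -/
noncomputable def Node.interRaw {S : Signature.{u}} : Node S → Node S → Node S
  | .mk es => fun n => .mk (Edge.interRawList es n.edges)
/-- Intersection of two transitions. -/
noncomputable def Edge.interRaw {S : Signature.{u}} : Edge S → Edge S → Edge S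
  | .mk s₁ ch₁ C₁ => fun e =>
    match e with
    | .mk s₂ ch₂ C₂ =>
      if h : s₁ = s₂ ∧ PCS.Consistent S (PCS.union C₁ C₂) then
        .mk s₁ (fun i => (ch₁ i).interRaw (ch₂ (Fin.cast (congrArg S.arity h.1) i)))
          (PCS.union C₁ C₂)
      else .bot
    | .bot => .bot
  | .bot => fun _ => .bot
noncomputable def Edge.interRawList {S : Signature.{u}} :
    List (Edge S) → List (Edge S) → List (Edge S)
  | [] => fun _ => []
  | e :: es => fun es' => es'.map (fun e' => e.interRaw e') ++ Edge.interRawList es es'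
end

open Classical in
mutual
/-- Normalization: a transition with an empty child becomes the empty transition, and empty
transitions are removed from their nodes. -/
noncomputable def Node.normalize {S : Signature.{u}} : Node S → Node S
  | .mk es => .mk (Edge.normalizeList es)
noncomputable def Edge.normalize {S : Signature.{u}} : Edge S → Edge S
  | .mk s ch C =>
    if ∃ i, (ch i).normalize = .mk [] then .bot else .mk s (fun i => (ch i).normalize) C
  | .bot => .bot
noncomputable def Edge.normalizeList {S : Signature.{u}} : List (Edge S) → List (Edge S)
  | [] => []
  | e :: es =>
    if e.normalize = .bot then Edge.normalizeList es
    else e.normalize :: Edge.normalizeList es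
end

/-- The intersection `n₁ ⊓ n₂` of two ECTAs (normalized). -/
noncomputable def Node.inter {S : Signature.{u}} (n₁ n₂ : Node S) : Node S :=
  (n₁.interRaw n₂).normalize

/-- `n.HasTransition e`: the transition `e` occurs in the ECTA `n`, at any depth. -/
inductive Node.HasTransition {S : Signature.{u}} : Node S → Edge S → Prop
  | here {n : Node S} {e : Edge S} (h : e ∈ n.edges) : Node.HasTransition n e
  | child {n : Node S} {s : S.Sym} {ch : Fin (S.arity s) → Node S} {C : PCS}
      (h : Edge.mk s ch C ∈ n.edges) (i : Fin (S.arity s)) {e : Edge S}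
      (he : Node.HasTransition (ch i) e) : Node.HasTransition n e

/-- No transition of `n` carries the trivial path equivalence class `{ε}`. -/
def Node.NoTrivialPEC {S : Signature.{u}} (n : Node S) : Prop :=
  ∀ s ch C, n.HasTransition (.mk s ch C) → ({[]} : PEC) ∉ C

/-- The path is in range at the node: whichever transitions are chosen, following the path never
asks for a child that does not exist. -/
def Node.InRange {S : Signature.{u}} : Node S → Path → Prop
  | _, [] => True
  | n, j :: p => ∀ (s : S.Sym) (ch : Fin (S.arity s) → Node S) (C : PCS),
      Edge.mk s ch C ∈ n.edges → ∃ h : j < S.arity s, (ch ⟨j, h⟩).InRange p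

/-- All constraint paths of `n` are in range at the transition that carries them. -/
def Node.PathsInRange {S : Signature.{u}} (n : Node S) : Prop :=
  ∀ s ch C, n.HasTransition (.mk s ch C) →
    ∀ c ∈ C, ∀ p ∈ c, (Node.mk [Edge.mk s ch C]).InRange p

/-- Constraint fragment sets: finite sets of pairs of a path equivalence class and a variable. -/
abbrev Frags (V : Type v) := Finset (PEC × V)

/-- The tails of the paths of `c` that start with `i`. -/
def PEC.project (c : PEC) (i : ℕ) : PEC :=
  (c.filter fun p => p.head? = some i).image List.tail

open Classical in
/-- Projection of a fragment set to the `i`-th child; fragments that become empty vanish. -/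
noncomputable def Frags.project {V : Type v} (Φ : Frags V) (i : ℕ) : Frags V :=
  (Φ.image fun φ => (φ.1.project i, φ.2)).filter fun φ => φ.1 ≠ ∅

/-- Partially enumerated terms. -/
inductive PTerm (S : Signature.{u}) (V : Type v) : Type (max u v)
  | var (x : V) : PTerm S V
  | app (s : S.Sym) (τs : Fin (S.arity s) → PTerm S V) : PTerm S V
  | unode (n : Node S) (Φ : Frags V) : PTerm S V

/-- One-hole contexts. In `app s i τs K` the hole is in the `i`-th argument and the other
arguments are given by `τs`. -/
inductive Ctx (S : Signature.{u}) (V : Type v) : Type (max u v)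
  | hole : Ctx S V
  | app (s : S.Sym) (i : Fin (S.arity s)) (τs : Fin (S.arity s) → PTerm S V) (K : Ctx S V) :
      Ctx S V

def Ctx.fill {S : Signature.{u}} {V : Type v} : Ctx S V → PTerm S V → PTerm S V
  | .hole, τ => τ
  | .app s i τs K, τ => .app s (Function.update τs i (K.fill τ))

/-- The u-nodes (node with fragment set) that occur in a p-term. -/
def PTerm.unodes {S : Signature.{u}} {V : Type v} : PTerm S V → Set (Node S × Frags V)
  | .var _ => ∅
  | .app _ τs => ⋃ i, (τs i).unodes
  | .unode n Φ => {(n, Φ)}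

/-- The variables that occur in a p-term outside of constraint fragments. -/
def PTerm.vars {S : Signature.{u}} {V : Type v} : PTerm S V → Set V
  | .var x => {x}
  | .app _ τs => ⋃ i, (τs i).vars
  | .unode _ _ => ∅

open Classical in
/-- Replace the variable `x` by the variable `y` everywhere, also in constraint fragments. -/
noncomputable def PTerm.subst {S : Signature.{u}} {V : Type v} (y x : V) :
    PTerm S V → PTerm S V
  | .var z => .var (if z = x then y else z)
  | .app s τs => .app s fun i => (τs i).subst y x
  | .unode n Φ => .unode n (Φ.image fun φ => (φ.1, if φ.2 = x then y else φ.2))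

/-- Enumeration states: partial maps from variables to p-terms. -/
abbrev EState (S : Signature.{u}) (V : Type v) := V → Option (PTerm S V)

/-- `x` is mentioned in a constraint fragment of `σ`. -/
def EState.Mentions {S : Signature.{u}} {V : Type v} (σ : EState S V) (x : V) : Prop :=
  ∃ w τ n Φ c, σ w = some τ ∧ (n, Φ) ∈ τ.unodes ∧ (c, x) ∈ Φ

/-- `x` is solved: no constraint fragment of `σ` mentions it. -/
def EState.Solved {S : Signature.{u}} {V : Type v} (σ : EState S V) (x : V) : Prop :=
  ¬ σ.Mentions x

/-- `x` is fresh: it is not in the domain of `σ` and occurs nowhere in `σ`. -/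
def EState.Fresh {S : Signature.{u}} {V : Type v} (σ : EState S V) (x : V) : Prop :=
  σ x = none ∧ ¬ σ.Mentions x ∧ ∀ w τ, σ w = some τ → x ∉ τ.vars

/-- No u-node in `σ` carries a constraint fragment. -/
def EState.FullyEnumerated {S : Signature.{u}} {V : Type v} (σ : EState S V) : Prop :=
  ∀ w τ n Φ, σ w = some τ → (n, Φ) ∈ τ.unodes → Φ = ∅

open Classical in
/-- The initial state, which maps the root variable to the unrestricted u-node of `n`. -/
noncomputable def EState.init {S : Signature.{u}} {V : Type v} (vtop : V) (n : Node S) :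
    EState S V :=
  Function.update (fun _ => none) vtop (some (.unode n ∅))

/-- `PDen σ ρ τ t` says that the pair `(t, ρ)` belongs to the denotation of the p-term `τ` relative
to the state `σ`, for a total substitution `ρ`. -/
inductive PDen {S : Signature.{u}} {V : Type v} (σ : EState S V) (ρ : V → Term S) :
    PTerm S V → Term S → Prop
  | app (s : S.Sym) (τs : Fin (S.arity s) → PTerm S V) (ts : Fin (S.arity s) → Term S)
      (h : ∀ i, PDen σ ρ (τs i) (ts i)) : PDen σ ρ (.app s τs) (.mk s ts)
  | unode (n : Node S) (Φ : Frags V) (t : Term S) (hn : t ∈ n.den)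
      (hΦ : ∀ φ ∈ Φ, ∀ p ∈ φ.1, t.at p = some (ρ φ.2)) : PDen σ ρ (.unode n Φ) t
  | var (x : V) (τ : PTerm S V) (t : Term S) (hx : σ x = some τ) (hτ : PDen σ ρ τ t)
      (ht : ρ x = t) : PDen σ ρ (.var x) t

/-- Denotation of a state: the restrictions to the domain of `σ` of those total substitutions that
are compatible with every component of `σ`. -/
def EState.den {S : Signature.{u}} {V : Type v} (σ : EState S V) : Set (V → Option (Term S)) :=
  {r | ∃ ρ : V → Term S, (∀ x τ, σ x = some τ → PDen σ ρ τ (ρ x)) ∧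
    r = fun x => (σ x).map fun _ => ρ x}

open Classical in
/-- The step of p-terms that chooses a transition of a u-node, relative to the state `σ` in which
it takes place. The constraints `c` of the transition become fragments labelled by pairwise
distinct fresh variables `w c`, and all fragments are projected to the children. Projection is
undefined on the empty path. If `guarded` is true, a transition with too few children for
the paths of the fragments is not chosen; if `guarded` is false, such paths are dropped. -/
inductive ChooseBox {S : Signature.{u}} {V : Type v} (guarded : Prop) (σ : EState S V) :
    PTerm S V → PTerm S V → Prop
  | mk (n : Node S) (Φ Ψ : Frags V) (s : S.Sym) (ch : Fin (S.arity s) → Node S) (C : PCS)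
      (w : PEC → V)
      (hmem : Edge.mk s ch C ∈ n.edges)
      (hfresh : ∀ c ∈ C, σ.Fresh (w c))
      (hinj : Set.InjOn w (C : Set PEC))
      (hε : ∀ x, (({[]} : PEC), x) ∉ Φ)
      (hΨ : Ψ = C.image (fun c => (c, w c)) ∪ Φ)
      (hdef : ∀ φ ∈ Ψ, [] ∉ φ.1)
      (hguard : guarded → ∀ φ ∈ Ψ, ∀ j p, j :: p ∈ φ.1 → j < S.arity s) :
      ChooseBox guarded σ (.unode n Φ) (.app s fun i => .unode (ch i) (Ψ.project i))

open Classical in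
/-- The step relation of the enumeration. -/
inductive Step {S : Signature.{u}} {V : Type v} (guarded : Prop) :
    EState S V → EState S V → Prop
  | choose (σ : EState S V) (x : V) (K : Ctx S V) (τ τ' : PTerm S V)
      (hx : σ x = some (K.fill τ)) (hτ : ChooseBox guarded σ τ τ') (hs : σ.Solved x) :
      Step guarded σ (Function.update σ x (some (K.fill τ')))
  | suspend₁ (σ : EState S V) (x x' : V) (K : Ctx S V) (n : Node S) (Φ : Frags V)
      (hx : σ x = some (K.fill (.unode n (insert ({[]}, x') Φ))))
      (hΦ : (({[]} : PEC), x') ∉ Φ) (hx' : σ x' = none) :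
      Step guarded σ (Function.update (Function.update σ x (some (K.fill (.var x'))))
        x' (some (.unode n Φ)))
  | suspend₂ (σ : EState S V) (x x' : V) (K : Ctx S V) (n n' : Node S) (Φ Φ' : Frags V)
      (hx : σ x = some (K.fill (.unode n (insert ({[]}, x') Φ))))
      (hΦ : (({[]} : PEC), x') ∉ Φ) (hx' : σ x' = some (.unode n' Φ')) :
      Step guarded σ (Function.update (Function.update σ x (some (K.fill (.var x'))))
        x' (some (.unode (n.inter n') (Φ ∪ Φ'))))
  | subst (σ : EState S V) (x₁ x₂ : V) (hx : σ x₂ = some (.var x₁)) :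
      Step guarded σ (fun y => (Function.update σ x₂ none y).map (PTerm.subst x₁ x₂))

/-- The values of the root variable over all fully enumerated states reachable from the initial
state of `n` and all substitutions in their denotations. -/
def enumerated {S : Signature.{u}} {V : Type v} (guarded : Prop) (vtop : V) (n : Node S) :
    Set (Term S) :=
  {t | ∃ σ : EState S V, Relation.ReflTransGen (Step guarded) (EState.init vtop n) σ ∧
    σ.FullyEnumerated ∧ ∃ r ∈ σ.den, r vtop = some t}

end ECTA

namespace ECTA

-- Both inclusions carry substitutions along runs while keeping the value of the root variable. They
-- work with `EState.Compat`, which reads a variable simply as its value under the substitution. The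
-- inductive `PDen` also demands that bindings be well founded, so it would not pass backwards
-- through the elimination of a variable bound to itself.
--
-- Soundness (`enumerated_subset_den`): every rule, read backwards, turns a compatible substitution
-- of the new state into one of the old state (`Step.exists_compat`). For a choice this holds
-- because the guard lets no constraint path get lost; for suspension because the intersection of
-- nodes denotes the intersection of denotations (`Node.mem_den_inter`); for elimination because the
-- removed variable can take the value of its replacement. The root is never referred to and hence
-- never removed (`Step.isRoot`).
--
-- Completeness (`den_subset_enumerated`): a given term of the denotation dictates the run, and a
-- substitution compatible with the state is maintained. Finiteness of terms is used three times,
-- always because a proper subterm is smaller. A class containing the empty path can only be `{[]}`,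
-- which the hypothesis excludes, so choices are never blocked. A variable of largest value among
-- those with fragments left in their components is solved, so some choice is always possible. At
-- the end bindings are well founded, so compatibility gives `PDen` (`EState.Inv.pden`). The run
-- proceeds in rounds: expand one u-node by the transition that the term uses
-- (`EState.Inv.exists_choose`), then remove all trivial fragments by suspension and elimination
-- (`EState.Inv.exists_drain`, `EState.Inv.exists_unify`). The sum of the sizes of the terms found
-- at the u-nodes drops at the choice, where a root symbol is consumed, and never grows afterwards;
-- so the rounds end.
--
-- For the unguarded rules, being in range passes to children and to intersections, so the guard
-- holds at every choice (`Step.guarded`).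

variable {S : Signature.{u}} {V : Type v}

-- Terms, paths and projections

/-- The number of symbols of a term. -/
def Term.size : Term S → ℕ
  | .mk _ ts => 1 + ∑ i, (ts i).size

theorem Term.size_pos (t : Term S) : 0 < t.size := by
  cases t; simp [Term.size]

theorem Term.size_lt_mk (s : S.Sym) (ts : Fin (S.arity s) → Term S) (i : Fin (S.arity s)) :
    (ts i).size < (Term.mk s ts).size := by
  have := Finset.single_le_sum (f := fun i => (ts i).size) (fun _ _ => Nat.zero_le _)
    (Finset.mem_univ i)
  simp only [Term.size] at *
  omega

@[simp] theorem Term.at_nil (t : Term S) : t.at [] = some t := by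
  cases t; rfl

theorem Term.at_cons {s : S.Sym} {ts : Fin (S.arity s) → Term S} {j : ℕ} {p : Path}
    {t' : Term S} : (Term.mk s ts).at (j :: p) = some t' ↔
      ∃ h : j < S.arity s, (ts ⟨j, h⟩).at p = some t' := by
  rw [Term.at]
  split_ifs with h <;> simp [h]

theorem Term.size_at_le {p : Path} : ∀ {t t' : Term S}, t.at p = some t' → t'.size ≤ t.size := by
  induction p with
  | nil => intro t t' h; simp at h; rw [h]
  | cons j p ih =>
    rintro ⟨s, ts⟩ t' h
    obtain ⟨hj, h⟩ := Term.at_cons.1 h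
    exact (ih h).trans (Term.size_lt_mk s ts _).le

theorem Term.size_at_lt {p : Path} (hp : p ≠ []) {t t' : Term S} (h : t.at p = some t') :
    t'.size < t.size := by
  cases p with
  | nil => exact absurd rfl hp
  | cons j p =>
    obtain ⟨s, ts⟩ := t
    obtain ⟨hj, h⟩ := Term.at_cons.1 h
    exact (Term.size_at_le h).trans_lt (Term.size_lt_mk s ts _)

/-- In a finite term a class that contains the empty path can only be the trivial class. -/
theorem PEC.eq_singleton_nil {c : PEC} {t t' : Term S} (h : ∀ p ∈ c, t.at p = some t')
    (hc : [] ∈ c) : c = {[]} := by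
  have ht : t = t' := by simpa using h [] hc
  subst ht
  refine Finset.eq_singleton_iff_unique_mem.2 ⟨hc, fun p hp => ?_⟩
  -- Otherwise a proper subterm of `t` would be `t` itself.
  by_contra hne
  exact (Term.size_at_lt hne (h p hp)).false

theorem PEC.mem_project {c : PEC} {i : ℕ} {p : Path} : p ∈ c.project i ↔ i :: p ∈ c := by
  simp only [PEC.project, Finset.mem_image, Finset.mem_filter]
  constructor
  · rintro ⟨q, ⟨hq, hi⟩, rfl⟩
    cases q with
    | nil => simp at hi
    | cons j q => simp at hi; subst hi; simpa using hq
  · intro h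
    exact ⟨i :: p, ⟨h, by simp⟩, by simp⟩

theorem Frags.mem_project {Φ : Frags V} {i : ℕ} {φ : PEC × V} :
    φ ∈ Φ.project i ↔ φ.1.Nonempty ∧ ∃ c, (c, φ.2) ∈ Φ ∧ φ.1 = c.project i := by
  obtain ⟨c', x⟩ := φ
  simp only [Frags.project, Finset.mem_filter, Finset.mem_image, Prod.mk.injEq, Prod.exists,
    Finset.nonempty_iff_ne_empty]
  constructor
  · rintro ⟨⟨c, y, h, h1, rfl⟩, h2⟩
    exact ⟨h2, c, h, h1.symm⟩
  · rintro ⟨h2, c, h, h1⟩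
    exact ⟨⟨c, x, h, h1.symm, rfl⟩, h2⟩

-- Merging path constraint sets

theorem PCS.subset_merge {C : PCS} {c : PEC} (hc : c ∈ C) : ∃ d ∈ C.merge, c ⊆ d := by
  classical
  refine ⟨_, Finset.mem_image_of_mem _ hc, ?_⟩
  exact Finset.le_sup (f := id) (Finset.mem_filter.2 ⟨hc, Relation.ReflTransGen.refl⟩)

theorem PCS.mem_merge {C : PCS} {d : PEC} : d ∈ C.merge ↔ ∃ c ∈ C, ∀ p, p ∈ d ↔
    ∃ c' ∈ C, Relation.ReflTransGen (PCS.Overlap C) c c' ∧ p ∈ c' := by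
  classical
  simp only [PCS.merge, Finset.mem_image]
  constructor
  · rintro ⟨c, hc, rfl⟩
    refine ⟨c, hc, fun p => ?_⟩
    simp [Finset.mem_sup, and_assoc]
  · rintro ⟨c, hc, h⟩
    refine ⟨c, hc, ?_⟩
    ext p
    simp [h, Finset.mem_sup, and_assoc]

/-- Overlapping classes share a path, so they lead to the same subterm, and this propagates along
chains of overlaps. -/
theorem PCS.sat_merge {C : PCS} {t : Term S} : C.merge.Sat t ↔ C.Sat t := by
  constructor
  · intro h c hc
    obtain ⟨d, hd, hcd⟩ := PCS.subset_merge hc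
    obtain ⟨t', ht'⟩ := h d hd
    exact ⟨t', fun p hp => ht' p (hcd hp)⟩
  · intro h d hd
    obtain ⟨c, hc, hd⟩ := PCS.mem_merge.1 hd
    obtain ⟨t', ht'⟩ := h c hc
    have key : ∀ c', Relation.ReflTransGen (PCS.Overlap C) c c' →
        ∀ p ∈ c', t.at p = some t' := by
      intro c' hc'
      induction hc' with
      | refl => exact ht'
      | tail _ hov ih =>
        obtain ⟨-, h2, h3⟩ := hov
        obtain ⟨q, hq1, hq2⟩ := Finset.not_disjoint_iff.1 h3
        obtain ⟨t'', ht''⟩ := h _ h2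
        have : t'' = t' := Option.some_injective _ ((ht'' q hq2).symm.trans (ih q hq1))
        exact this ▸ ht''
    refine ⟨t', fun p hp => ?_⟩
    obtain ⟨c', -, hc', hp⟩ := (hd p).1 hp
    exact key c' hc' p hp

theorem PCS.sat_union {C₁ C₂ : PCS} {t : Term S} :
    (PCS.union C₁ C₂).Sat t ↔ C₁.Sat t ∧ C₂.Sat t := by
  classical
  rw [PCS.union, PCS.sat_merge]
  simp only [PCS.Sat, Finset.mem_union]
  exact ⟨fun h => ⟨fun c hc => h c (.inl hc), fun c hc => h c (.inr hc)⟩,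
    fun h c hc => hc.elim (h.1 c) (h.2 c)⟩

theorem PCS.exists_of_mem_union {C₁ C₂ : PCS} {c : PEC} (hc : c ∈ PCS.union C₁ C₂)
    {p : Path} (hp : p ∈ c) : ∃ c', (c' ∈ C₁ ∨ c' ∈ C₂) ∧ p ∈ c' := by
  classical
  obtain ⟨d, -, h⟩ := PCS.mem_merge.1 hc
  obtain ⟨c', hc', -, hp⟩ := (h p).1 hp
  exact ⟨c', Finset.mem_union.1 hc', hp⟩

/-- A merged class is a union of original classes; the one that contributes the empty path lies
inside `{[]}`, so it was trivial already. -/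
theorem PCS.singleton_nil_mem_union {C₁ C₂ : PCS} (h : ({[]} : PEC) ∈ PCS.union C₁ C₂) :
    ({[]} : PEC) ∈ C₁ ∨ ({[]} : PEC) ∈ C₂ := by
  classical
  obtain ⟨d, -, h⟩ := PCS.mem_merge.1 h
  obtain ⟨c', hc', hr, hp⟩ := (h []).1 (by simp)
  have : c' = {[]} := by
    refine Finset.eq_singleton_iff_unique_mem.2 ⟨hp, fun q hq => ?_⟩
    simpa using (h q).2 ⟨c', hc', hr, hq⟩
  exact this ▸ Finset.mem_union.1 hc'

-- Denotation and intersection of nodes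

theorem Edge.mem_denList {es : List (Edge S)} {t : Term S} :
    t ∈ Edge.denList es ↔ ∃ e ∈ es, t ∈ e.den := by
  induction es with
  | nil => simp [Edge.denList]
  | cons e es ih => simp [Edge.denList, ih]

theorem Node.mem_den {n : Node S} {s : S.Sym} {ts : Fin (S.arity s) → Term S} :
    Term.mk s ts ∈ n.den ↔ ∃ ch C, Edge.mk s ch C ∈ n.edges ∧ (∀ i, ts i ∈ (ch i).den) ∧
      PCS.Sat C (.mk s ts) := by
  obtain ⟨es⟩ := n
  rw [Node.den, Edge.mem_denList]
  constructor
  · rintro ⟨e, he, ht⟩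
    cases e with
    | bot => simp [Edge.den] at ht
    | mk s' ch C =>
      rw [Edge.den] at ht
      obtain ⟨ts', h, hts, hC⟩ := ht
      cases h
      exact ⟨ch, C, he, hts, hC⟩
  · rintro ⟨ch, C, he, hts, hC⟩
    refine ⟨_, he, ?_⟩
    rw [Edge.den]
    exact ⟨ts, rfl, hts, hC⟩

theorem Edge.mem_interRawList {es es' : List (Edge S)} {e : Edge S} :
    e ∈ Edge.interRawList es es' ↔ ∃ e₁ ∈ es, ∃ e₂ ∈ es', e = e₁.interRaw e₂ := by
  induction es with
  | nil => simp [Edge.interRawList]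
  | cons a es ih =>
    rw [Edge.interRawList, List.mem_append, ih]
    simp [eq_comm]

theorem Edge.mem_normalizeList {es : List (Edge S)} {e : Edge S} :
    e ∈ Edge.normalizeList es ↔ e ≠ .bot ∧ ∃ e' ∈ es, e = e'.normalize := by
  induction es with
  | nil => simp [Edge.normalizeList]
  | cons a es ih =>
    rw [Edge.normalizeList]
    split_ifs with h
    · rw [ih]
      constructor
      · rintro ⟨h1, e', h2, h3⟩
        exact ⟨h1, e', List.mem_cons_of_mem _ h2, h3⟩
      · rintro ⟨h1, e', h2, h3⟩
        rcases List.mem_cons.1 h2 with rfl | h2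
        · exact absurd (h3.trans h) h1
        · exact ⟨h1, e', h2, h3⟩
    · rw [List.mem_cons, ih]
      constructor
      · rintro (rfl | ⟨h1, e', h2, h3⟩)
        · exact ⟨h, a, List.mem_cons_self, rfl⟩
        · exact ⟨h1, e', List.mem_cons_of_mem _ h2, h3⟩
      · rintro ⟨h1, e', h2, h3⟩
        rcases List.mem_cons.1 h2 with rfl | h2
        · exact .inl h3
        · exact .inr ⟨h1, e', h2, h3⟩

theorem Node.edges_inter (n₁ n₂ : Node S) :
    (n₁.inter n₂).edges = Edge.normalizeList (Edge.interRawList n₁.edges n₂.edges) := by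
  obtain ⟨es⟩ := n₁
  rw [Node.inter, Node.interRaw, Node.normalize]
  rfl

theorem Node.mem_edges_inter {n₁ n₂ : Node S} {s : S.Sym} {ch : Fin (S.arity s) → Node S}
    {C : PCS} : Edge.mk s ch C ∈ (n₁.inter n₂).edges ↔
      ∃ ch₁ C₁ ch₂ C₂, Edge.mk s ch₁ C₁ ∈ n₁.edges ∧ Edge.mk s ch₂ C₂ ∈ n₂.edges ∧
        PCS.Consistent S (PCS.union C₁ C₂) ∧ C = PCS.union C₁ C₂ ∧
        (ch = fun i => (ch₁ i).inter (ch₂ i)) ∧ ∀ i, ch i ≠ .mk [] := by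
  classical
  rw [Node.edges_inter, Edge.mem_normalizeList]
  constructor
  · rintro ⟨-, e', he', h⟩
    obtain ⟨e₁, h₁, e₂, h₂, rfl⟩ := Edge.mem_interRawList.1 he'
    cases e₁ with
    | bot => simp [Edge.interRaw, Edge.normalize] at h
    | mk s₁ ch₁ C₁ =>
      cases e₂ with
      | bot => simp [Edge.interRaw, Edge.normalize] at h
      | mk s₂ ch₂ C₂ =>
        rw [Edge.interRaw] at h
        dsimp only at h
        split_ifs at h with hs
        · obtain ⟨rfl, hs⟩ := hs
          rw [Edge.normalize] at h
          split_ifs at h with hb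
          cases h
          push Not at hb
          exact ⟨ch₁, C₁, ch₂, C₂, h₁, h₂, hs, rfl, rfl, hb⟩
        · simp [Edge.normalize] at h
  · rintro ⟨ch₁, C₁, ch₂, C₂, h₁, h₂, hs, rfl, rfl, hb⟩
    refine ⟨by simp, _, Edge.mem_interRawList.2 ⟨_, h₁, _, h₂, rfl⟩, ?_⟩
    rw [Edge.interRaw]
    dsimp only
    rw [dif_pos ⟨rfl, hs⟩, Edge.normalize, if_neg]
    · rfl
    · rintro ⟨i, hi⟩
      exact hb i hi

theorem Node.not_mem_den_nil (t : Term S) : t ∉ (Node.mk [] : Node S).den := by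
  simp [Node.den, Edge.denList]

/-- The intersection of nodes denotes the intersection of the denotations. -/
theorem Node.mem_den_inter {t : Term S} : ∀ {n₁ n₂ : Node S},
    t ∈ (n₁.inter n₂).den ↔ t ∈ n₁.den ∧ t ∈ n₂.den := by
  induction t with
  | mk s ts ih =>
    intro n₁ n₂
    simp only [Node.mem_den, Node.mem_edges_inter]
    constructor
    · rintro ⟨_, _, ⟨ch₁, C₁, ch₂, C₂, h₁, h₂, -, rfl, rfl, -⟩, hts, hC⟩
      have hC := PCS.sat_union.1 hC
      exact ⟨⟨ch₁, C₁, h₁, fun i => ((ih i).1 (hts i)).1, hC.1⟩,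
        ⟨ch₂, C₂, h₂, fun i => ((ih i).1 (hts i)).2, hC.2⟩⟩
    · rintro ⟨⟨ch₁, C₁, h₁, ht₁, hC₁⟩, ⟨ch₂, C₂, h₂, ht₂, hC₂⟩⟩
      have hC := PCS.sat_union.2 ⟨hC₁, hC₂⟩
      have hts := fun i => (ih i).2 ⟨ht₁ i, ht₂ i⟩
      -- The term itself witnesses consistency, and its arguments show that no child is empty; so
      -- neither the consistency test nor normalization removes this transition.
      refine ⟨_, _, ⟨ch₁, C₁, ch₂, C₂, h₁, h₂, ⟨_, hC⟩, rfl, rfl, fun i hi => ?_⟩, hts, hC⟩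
      have := hts i
      rw [hi] at this
      exact Node.not_mem_den_nil _ this

-- Conditions on nodes inherited by children and intersections

theorem Node.NoTrivialPEC.child {n : Node S} (hn : n.NoTrivialPEC) {s : S.Sym}
    {ch : Fin (S.arity s) → Node S} {C : PCS} (h : Edge.mk s ch C ∈ n.edges)
    (i : Fin (S.arity s)) : (ch i).NoTrivialPEC :=
  fun _ _ _ h' => hn _ _ _ (.child h i h')

/-- A transition of an intersection is made of transitions of the two nodes, at any depth. -/
theorem Node.HasTransition.of_inter {n : Node S} {e : Edge S} (h : n.HasTransition e) :
    ∀ {n₁ n₂ : Node S}, n = n₁.inter n₂ → ∀ {s ch C}, e = .mk s ch C →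
      ∃ ch₁ C₁ ch₂ C₂, n₁.HasTransition (.mk s ch₁ C₁) ∧ n₂.HasTransition (.mk s ch₂ C₂) ∧
        C = PCS.union C₁ C₂ ∧ ch = fun i => (ch₁ i).inter (ch₂ i) := by
  induction h with
  | here h =>
    rintro n₁ n₂ rfl s ch C rfl
    obtain ⟨ch₁, C₁, ch₂, C₂, h₁, h₂, -, h3, h4, -⟩ := Node.mem_edges_inter.1 h
    exact ⟨ch₁, C₁, ch₂, C₂, .here h₁, .here h₂, h3, h4⟩
  | child h i _ ih =>
    rintro n₁ n₂ rfl s ch C rfl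
    obtain ⟨ch₁, C₁, ch₂, C₂, h₁, h₂, -, -, rfl, -⟩ := Node.mem_edges_inter.1 h
    obtain ⟨ch₁', C₁', ch₂', C₂', h₁', h₂', h⟩ := ih rfl rfl
    exact ⟨ch₁', C₁', ch₂', C₂', .child h₁ i h₁', .child h₂ i h₂', h⟩

theorem Node.NoTrivialPEC.inter {n₁ n₂ : Node S} (h₁ : n₁.NoTrivialPEC)
    (h₂ : n₂.NoTrivialPEC) : (n₁.inter n₂).NoTrivialPEC := by
  intro s ch C h hC
  obtain ⟨ch₁, C₁, ch₂, C₂, h1, h2, rfl, -⟩ := h.of_inter rfl rfl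
  exact (PCS.singleton_nil_mem_union hC).elim (h₁ _ _ _ h1) (h₂ _ _ _ h2)

theorem Node.inRange_singleton {s : S.Sym} {ch : Fin (S.arity s) → Node S} {C : PCS} {j : ℕ}
    {p : Path} : (Node.mk [Edge.mk s ch C]).InRange (j :: p) ↔
      ∃ h : j < S.arity s, (ch ⟨j, h⟩).InRange p := by
  rw [Node.InRange]
  constructor
  · intro h
    exact h s ch C (by simp [Node.edges])
  · intro h s' ch' C' he
    simp only [Node.edges, List.mem_singleton] at he
    cases he
    exact h

/-- Each transition of an intersection comes from one of the left factor, so the choices met along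
the path are already covered there. -/
theorem Node.InRange.inter_left {p : Path} : ∀ {n₁ n₂ : Node S}, n₁.InRange p →
    (n₁.inter n₂).InRange p := by
  induction p with
  | nil => intros; trivial
  | cons j p ih =>
    intro n₁ n₂ h s ch C he
    obtain ⟨ch₁, C₁, ch₂, C₂, h₁, h₂, -, -, rfl, -⟩ := Node.mem_edges_inter.1 he
    obtain ⟨hj, h⟩ := h s ch₁ C₁ h₁
    exact ⟨hj, ih h⟩

theorem Node.InRange.inter_right {p : Path} : ∀ {n₁ n₂ : Node S}, n₂.InRange p →
    (n₁.inter n₂).InRange p := by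
  induction p with
  | nil => intros; trivial
  | cons j p ih =>
    intro n₁ n₂ h s ch C he
    obtain ⟨ch₁, C₁, ch₂, C₂, h₁, h₂, -, -, rfl, -⟩ := Node.mem_edges_inter.1 he
    obtain ⟨hj, h⟩ := h s ch₂ C₂ h₂
    exact ⟨hj, ih h⟩

theorem Node.PathsInRange.child {n : Node S} (hn : n.PathsInRange) {s : S.Sym}
    {ch : Fin (S.arity s) → Node S} {C : PCS} (h : Edge.mk s ch C ∈ n.edges)
    (i : Fin (S.arity s)) : (ch i).PathsInRange :=
  fun _ _ _ h' => hn _ _ _ (.child h i h')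

/-- Merging creates no new paths: each path of a merged class belongs to a class of one of the
factors. -/
theorem Node.PathsInRange.inter {n₁ n₂ : Node S} (h₁ : n₁.PathsInRange)
    (h₂ : n₂.PathsInRange) : (n₁.inter n₂).PathsInRange := by
  intro s ch C h c hc p hp
  obtain ⟨ch₁, C₁, ch₂, C₂, h1, h2, rfl, rfl⟩ := h.of_inter rfl rfl
  obtain ⟨c', hc', hp'⟩ := PCS.exists_of_mem_union hc hp
  cases p with
  | nil => trivial
  | cons j p =>
    rw [Node.inRange_singleton]
    rcases hc' with hc' | hc'
    · obtain ⟨hj, h⟩ := Node.inRange_singleton.1 (h₁ _ _ _ h1 c' hc' _ hp')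
      exact ⟨hj, h.inter_left⟩
    · obtain ⟨hj, h⟩ := Node.inRange_singleton.1 (h₂ _ _ _ h2 c' hc' _ hp')
      exact ⟨hj, h.inter_right⟩

-- Compatibility, contexts and weights

/-- The terms denoted by a p-term when variables denote their value under `ρ`, whether or not they
belong to the domain of a state. -/
def PTerm.Denotes (ρ : V → Term S) : PTerm S V → Term S → Prop
  | .var x, t => ρ x = t
  | .app s τs, t => ∃ ts, t = .mk s ts ∧ ∀ i, (τs i).Denotes ρ (ts i)
  | .unode n Φ, t => t ∈ n.den ∧ ∀ φ ∈ Φ, ∀ p ∈ φ.1, t.at p = some (ρ φ.2)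

/-- Every component of `σ` denotes the value of its variable. -/
def EState.Compat (σ : EState S V) (ρ : V → Term S) : Prop :=
  ∀ x τ, σ x = some τ → τ.Denotes ρ (ρ x)

/-- Forgets that bindings are well founded. The converse for tidy states is `EState.Inv.pden`. -/
theorem PDen.denotes {σ : EState S V} {ρ : V → Term S} {τ : PTerm S V} {t : Term S}
    (h : PDen σ ρ τ t) : τ.Denotes ρ t := by
  induction h with
  | app s τs ts _ ih => exact ⟨ts, rfl, ih⟩
  | unode n Φ t hn hΦ => exact ⟨hn, hΦ⟩
  | var x τ t hx _ ht _ => exact ht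

/-- The `i`-th argument of a term. -/
def Term.child : Term S → ℕ → Term S
  | .mk s ts, i => if h : i < S.arity s then ts ⟨i, h⟩ else .mk s ts

@[simp] theorem Term.child_mk (s : S.Sym) (ts : Fin (S.arity s) → Term S)
    (i : Fin (S.arity s)) : (Term.mk s ts).child i = ts i := by
  simp [Term.child]

/-- The total size of the subterms of `t` that are found at the u-nodes of a p-term. -/
def PTerm.weight : PTerm S V → Term S → ℕ
  | .var _, _ => 0
  | .app _ τs, t => ∑ i, (τs i).weight (t.child i)
  | .unode _ _, t => t.size

/-- The value at the hole of a context: its p-term may be exchanged for any other that denotes this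
value, under every substitution for which the rest of the context keeps its value. -/
theorem Ctx.exists_hole_forall (ρ : V → Term S) (K : Ctx S V) (τ : PTerm S V) :
    ∀ {t : Term S}, (K.fill τ).Denotes ρ t → ∃ t₀ k, τ.Denotes ρ t₀ ∧
      (∀ τ' : PTerm S V, (K.fill τ').weight t = k + τ'.weight t₀) ∧
      ∀ ρ' : V → Term S, (K.fill τ).Denotes ρ' t → ∀ τ' : PTerm S V, τ'.Denotes ρ' t₀ →
        (K.fill τ').Denotes ρ' t := by
  induction K with
  | hole => exact fun {t} h => ⟨t, 0, h, fun τ' => (Nat.zero_add _).symm, fun _ _ _ h => h⟩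
  | app s i τs K ih =>
    rintro _ ⟨ts, rfl, h⟩
    have hi := h i
    rw [Function.update_self] at hi
    obtain ⟨t₀, k, h1, h2, h3⟩ := ih hi
    -- The offset collects the weights of the arguments beside the hole.
    refine ⟨t₀, k + ∑ j ∈ Finset.univ.erase i, (τs j).weight (ts j), h1, fun τ' => ?_, ?_⟩
    · simp only [Ctx.fill, PTerm.weight, Term.child_mk]
      rw [← Finset.add_sum_erase _ _ (Finset.mem_univ i), Function.update_self, h2 τ']
      rw [Finset.sum_congr rfl fun j hj => by
        rw [Function.update_of_ne (Finset.ne_of_mem_erase hj)]]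
      omega
    · rintro ρ' ⟨ts', hts, h⟩ τ' h'
      cases hts
      refine ⟨ts, rfl, fun j => ?_⟩
      have hj := h j
      by_cases hji : j = i
      · subst hji
        rw [Function.update_self] at hj ⊢
        exact h3 ρ' hj τ' h'
      · rw [Function.update_of_ne hji] at hj ⊢
        exact hj

theorem Ctx.exists_hole (ρ : V → Term S) (K : Ctx S V) (τ : PTerm S V) {t : Term S}
    (h : (K.fill τ).Denotes ρ t) : ∃ t₀ k, τ.Denotes ρ t₀ ∧
      ∀ τ' : PTerm S V, (τ'.Denotes ρ t₀ → (K.fill τ').Denotes ρ t) ∧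
        (K.fill τ').weight t = k + τ'.weight t₀ := by
  obtain ⟨t₀, k, h1, h2, h3⟩ := K.exists_hole_forall ρ τ h
  exact ⟨t₀, k, h1, fun τ' => ⟨h3 ρ h τ', h2 τ'⟩⟩

-- Occurrences of u-nodes and variables

theorem Ctx.mem_unodes_fill {K : Ctx S V} {τ τ' : PTerm S V} {u : Node S × Frags V}
    (h : u ∈ (K.fill τ').unodes) : u ∈ (K.fill τ).unodes ∨ u ∈ τ'.unodes := by
  induction K with
  | hole => exact .inr h
  | app s i τs K ih =>
    simp only [Ctx.fill, PTerm.unodes, Set.mem_iUnion] at h ⊢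
    obtain ⟨j, h⟩ := h
    by_cases hj : j = i
    · subst hj
      rw [Function.update_self] at h
      refine (ih h).imp_left fun h => ⟨j, ?_⟩
      rwa [Function.update_self]
    · refine .inl ⟨j, ?_⟩
      rwa [Function.update_of_ne hj] at h ⊢

theorem Ctx.unodes_subset_fill (K : Ctx S V) (τ : PTerm S V) :
    τ.unodes ⊆ (K.fill τ).unodes := by
  induction K with
  | hole => exact subset_rfl
  | app s i τs K ih =>
    intro u hu
    simp only [Ctx.fill, PTerm.unodes, Set.mem_iUnion]
    exact ⟨i, by rw [Function.update_self]; exact ih hu⟩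

theorem Ctx.mem_unodes_fill_self (K : Ctx S V) (n : Node S) (Φ : Frags V) :
    (n, Φ) ∈ (K.fill (.unode n Φ)).unodes :=
  K.unodes_subset_fill _ (by simp [PTerm.unodes])

theorem Ctx.mem_vars_fill {K : Ctx S V} {τ τ' : PTerm S V} {y : V}
    (h : y ∈ (K.fill τ').vars) : y ∈ (K.fill τ).vars ∨ y ∈ τ'.vars := by
  induction K with
  | hole => exact .inr h
  | app s i τs K ih =>
    simp only [Ctx.fill, PTerm.vars, Set.mem_iUnion] at h ⊢
    obtain ⟨j, h⟩ := h
    by_cases hj : j = i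
    · subst hj
      rw [Function.update_self] at h
      refine (ih h).imp_left fun h => ⟨j, ?_⟩
      rwa [Function.update_self]
    · refine .inl ⟨j, ?_⟩
      rwa [Function.update_of_ne hj] at h ⊢

/-- Every u-node of a p-term is the hole of a context. -/
theorem PTerm.exists_fill_of_mem_unodes {τ : PTerm S V} {n : Node S} {Φ : Frags V}
    (h : (n, Φ) ∈ τ.unodes) : ∃ K : Ctx S V, τ = K.fill (.unode n Φ) := by
  induction τ with
  | var x => simp [PTerm.unodes] at h
  | unode n' Φ' =>
    simp only [PTerm.unodes, Set.mem_singleton_iff, Prod.mk.injEq] at h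
    obtain ⟨rfl, rfl⟩ := h
    exact ⟨.hole, rfl⟩
  | app s τs ih =>
    simp only [PTerm.unodes, Set.mem_iUnion] at h
    obtain ⟨i, h⟩ := h
    obtain ⟨K, hK⟩ := ih i h
    exact ⟨.app s i τs K, by rw [Ctx.fill, ← hK, Function.update_eq_self]⟩

open Classical in
theorem PTerm.mem_unodes_subst {τ : PTerm S V} {x y : V} {n : Node S} {Ψ : Frags V} :
    (n, Ψ) ∈ (τ.subst y x).unodes ↔ ∃ Φ, (n, Φ) ∈ τ.unodes ∧
      Ψ = Φ.image fun φ => (φ.1, if φ.2 = x then y else φ.2) := by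
  induction τ with
  | var z => simp [PTerm.subst, PTerm.unodes]
  | app s τs ih => simp only [PTerm.subst, PTerm.unodes, Set.mem_iUnion, ih]; aesop
  | unode n' Φ => simp [PTerm.subst, PTerm.unodes]

open Classical in
theorem PTerm.mem_vars_subst {τ : PTerm S V} {x y z : V} :
    z ∈ (τ.subst y x).vars ↔ ∃ w ∈ τ.vars, z = if w = x then y else w := by
  induction τ with
  | var w => simp [PTerm.subst, PTerm.vars]
  | app s τs ih => simp only [PTerm.subst, PTerm.vars, Set.mem_iUnion, ih]; aesop
  | unode n' Φ => simp [PTerm.subst, PTerm.vars]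

theorem PTerm.weight_subst (τ : PTerm S V) (x y : V) :
    ∀ t : Term S, (τ.subst y x).weight t = τ.weight t := by
  induction τ with
  | var z => exact fun _ => rfl
  | app s τs ih => exact fun t => by simp only [PTerm.subst, PTerm.weight, ih]
  | unode n Φ => exact fun _ => rfl

/-- Under a substitution that identifies `x` and `y`, replacing `x` by `y` changes nothing. -/
theorem PTerm.denotes_subst {ρ : V → Term S} {x y : V} (h : ρ x = ρ y) {τ : PTerm S V} :
    ∀ {t : Term S}, (τ.subst y x).Denotes ρ t ↔ τ.Denotes ρ t := by
  classical
  have key : ∀ z, ρ (if z = x then y else z) = ρ z := by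
    intro z
    split_ifs with hz
    · rw [hz, h]
    · rfl
  induction τ with
  | var z => intro t; simp only [PTerm.subst, PTerm.Denotes, key]
  | app s τs ih => intro t; simp only [PTerm.subst, PTerm.Denotes, ih]
  | unode n Φ =>
    intro t
    simp only [PTerm.subst, PTerm.Denotes, Finset.forall_mem_image, key]

/-- The variables that are mentioned in a constraint fragment of a p-term. -/
def PTerm.Mentions (τ : PTerm S V) (x : V) : Prop :=
  ∃ n Φ c, (n, Φ) ∈ τ.unodes ∧ (c, x) ∈ Φ

theorem EState.mentions_iff {σ : EState S V} {x : V} :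
    σ.Mentions x ↔ ∃ w τ, σ w = some τ ∧ τ.Mentions x := by
  constructor
  · rintro ⟨w, τ, n, Φ, c, h1, h2, h3⟩
    exact ⟨w, τ, h1, n, Φ, c, h2, h3⟩
  · rintro ⟨w, τ, h1, n, Φ, c, h2, h3⟩
    exact ⟨w, τ, n, Φ, c, h1, h2, h3⟩

theorem PTerm.mentions_unode {n : Node S} {Φ : Frags V} {x : V} :
    (PTerm.unode n Φ).Mentions x ↔ ∃ c, (c, x) ∈ Φ := by
  simp [PTerm.Mentions, PTerm.unodes]

theorem PTerm.not_mentions_var {x y : V} : ¬ (PTerm.var y : PTerm S V).Mentions x := by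
  simp [PTerm.Mentions, PTerm.unodes]

theorem PTerm.mentions_app {s : S.Sym} {τs : Fin (S.arity s) → PTerm S V} {x : V} :
    (PTerm.app s τs).Mentions x ↔ ∃ i, (τs i).Mentions x := by
  simp only [PTerm.Mentions, PTerm.unodes, Set.mem_iUnion]
  aesop

theorem Ctx.mentions_fill {K : Ctx S V} {τ τ' : PTerm S V} {x : V}
    (h : (K.fill τ').Mentions x) : (K.fill τ).Mentions x ∨ τ'.Mentions x := by
  obtain ⟨n, Φ, c, h1, h2⟩ := h
  exact (Ctx.mem_unodes_fill h1).imp (fun h => ⟨n, Φ, c, h, h2⟩) fun h => ⟨n, Φ, c, h, h2⟩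

theorem Ctx.mentions_fill_of_mentions (K : Ctx S V) {τ : PTerm S V} {x : V}
    (h : τ.Mentions x) : (K.fill τ).Mentions x := by
  obtain ⟨n, Φ, c, h1, h2⟩ := h
  exact ⟨n, Φ, c, K.unodes_subset_fill τ h1, h2⟩

open Classical in
theorem PTerm.Mentions.of_subst {τ : PTerm S V} {x y z : V} (h : (τ.subst y x).Mentions z) :
    ∃ w, τ.Mentions w ∧ z = if w = x then y else w := by
  obtain ⟨n, Ψ, c, h, h2⟩ := h
  obtain ⟨Φ, h1, rfl⟩ := PTerm.mem_unodes_subst.1 h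
  obtain ⟨⟨c', w⟩, h3, h4⟩ := Finset.mem_image.1 h2
  cases h4
  exact ⟨w, ⟨n, Φ, _, h1, h3⟩, rfl⟩

open Classical in
theorem EState.update_eq_some {σ : EState S V} {x y : V} {τ τ' : PTerm S V} :
    Function.update σ x (some τ) y = some τ' ↔ (y = x ∧ τ' = τ) ∨ (y ≠ x ∧ σ y = some τ') := by
  by_cases h : y = x
  · subst h
    simp [eq_comm]
  · simp [h]

open Classical in
theorem EState.subst_eq_some {σ : EState S V} {x y z : V} {τ' : PTerm S V} :
    (Function.update σ x none z).map (PTerm.subst y x) = some τ' ↔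
      z ≠ x ∧ ∃ τ, σ z = some τ ∧ τ' = τ.subst y x := by
  by_cases h : z = x
  · subst h
    simp
  · simp [h, eq_comm]

-- Soundness: the root variable survives

/-- The fragments and variables of a state never refer to `x`, which is bound to an application
or to an unrestricted u-node. -/
structure EState.IsRoot (σ : EState S V) (x : V) : Prop where
  head : ∃ τ, σ x = some τ ∧ ((∃ n, τ = .unode n ∅) ∨ ∃ s τs, τ = .app s τs)
  not_mentions : ∀ w τ, σ w = some τ → ¬ τ.Mentions x
  not_mem_vars : ∀ w τ, σ w = some τ → x ∉ τ.vars

theorem EState.isRoot_init (vtop : V) (n : Node S) : (EState.init vtop n).IsRoot vtop := by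
  classical
  have key : ∀ w τ, EState.init vtop n w = some τ → τ = .unode n ∅ := by
    intro w τ h
    rcases EState.update_eq_some.1 h with ⟨-, h⟩ | ⟨-, h⟩
    · exact h
    · simp at h
  refine ⟨⟨.unode n ∅, by simp [EState.init], .inl ⟨n, rfl⟩⟩, fun w τ h => ?_, fun w τ h => ?_⟩
  · rw [key w τ h, PTerm.mentions_unode]
    simp
  · rw [key w τ h]
    simp [PTerm.vars]

theorem Ctx.fill_app (K : Ctx S V) (s : S.Sym) (τs : Fin (S.arity s) → PTerm S V) :
    ∃ s' τs', K.fill (.app s τs) = .app s' τs' := by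
  cases K with
  | hole => exact ⟨s, τs, rfl⟩
  | app s' i τs' K => exact ⟨_, _, rfl⟩

/-- In the hole of a context is the whole p-term, or the p-term is an application. -/
theorem Ctx.eq_hole_or_fill_app (K : Ctx S V) :
    K = .hole ∨ ∀ τ, ∃ s τs, K.fill τ = .app s τs := by
  cases K with
  | hole => exact .inl rfl
  | app s' i τs' K => exact .inr fun τ => ⟨_, _, rfl⟩

open Classical in
theorem EState.IsRoot.update {σ : EState S V} {x y : V} {τ : PTerm S V} (h : σ.IsRoot x)
    (hy : y = x → (∃ n, τ = .unode n ∅) ∨ ∃ s τs, τ = .app s τs) (hm : ¬ τ.Mentions x)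
    (hv : x ∉ τ.vars) : EState.IsRoot (Function.update σ y (some τ)) x := by
  refine ⟨?_, fun w τ' h' => ?_, fun w τ' h' => ?_⟩
  · by_cases hxy : x = y
    · exact ⟨τ, by simp [hxy], hy hxy.symm⟩
    · rw [Function.update_of_ne hxy]
      exact h.head
  · rcases EState.update_eq_some.1 h' with ⟨-, rfl⟩ | ⟨-, h'⟩
    · exact hm
    · exact h.not_mentions w τ' h'
  · rcases EState.update_eq_some.1 h' with ⟨-, rfl⟩ | ⟨-, h'⟩
    · exact hv
    · exact h.not_mem_vars w τ' h'

open Classical in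
/-- Suspending a u-node does not affect the root. -/
theorem EState.IsRoot.suspend {σ : EState S V} {r x x' : V} (hr : σ.IsRoot r) {K : Ctx S V}
    {n m : Node S} {Φ Φ' : Frags V}
    (hx : σ x = some (K.fill (.unode n (insert ({[]}, x') Φ))))
    (hΦ' : ∀ φ ∈ Φ', φ.2 ≠ r) :
    EState.IsRoot (Function.update (Function.update σ x (some (K.fill (.var x'))))
      x' (some (.unode m Φ'))) r := by
  have hx'r : x' ≠ r := by
    rintro rfl
    exact hr.not_mentions _ _ hx
      (K.mentions_fill_of_mentions (PTerm.mentions_unode.2 ⟨{[]}, by simp⟩))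
  refine EState.IsRoot.update (EState.IsRoot.update hr ?_ ?_ ?_) (fun h => absurd h hx'r) ?_ ?_
  · rintro rfl
    rcases K.eq_hole_or_fill_app with rfl | hK
    · obtain ⟨τ, h1, h2⟩ := hr.head
      rw [hx] at h1
      cases h1
      simp [Ctx.fill] at h2
    · exact .inr (hK _)
  · intro h
    exact (Ctx.mentions_fill h).elim (hr.not_mentions _ _ hx) PTerm.not_mentions_var
  · intro h
    refine (Ctx.mem_vars_fill h).elim (hr.not_mem_vars _ _ hx) fun h => hx'r ?_
    simpa [PTerm.vars, eq_comm] using h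
  · rw [PTerm.mentions_unode]
    rintro ⟨c, hc⟩
    exact hΦ' _ hc rfl
  · simp [PTerm.vars]

/-- New references are to fresh variables, to variables already mentioned, or to the target of a
binding, and none of these is the root. A top-level u-node of the root has no fragment, so the root
is never suspended to a bare variable and hence never eliminated. -/
theorem Step.isRoot {g : Prop} {σ σ' : EState S V} (hstep : Step g σ σ') {r : V}
    (hr : σ.IsRoot r) : σ'.IsRoot r := by
  classical
  have hΦ : ∀ {x K n} {Φ : Frags V}, σ x = some (Ctx.fill K (.unode n Φ)) →
      ∀ φ ∈ Φ, φ.2 ≠ r := by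
    rintro x K n Φ hx ⟨c, y⟩ hφ rfl
    exact hr.not_mentions _ _ hx
      (K.mentions_fill_of_mentions (PTerm.mentions_unode.2 ⟨c, hφ⟩))
  cases hstep with
  | choose x K τ τ' hx hτ hs =>
    cases hτ with
    | mk n Φ Ψ s ch C w hmem hfresh hinj hε hΨ hdef hguard =>
      refine hr.update (fun _ => .inr (K.fill_app _ _)) ?_ ?_
      · intro h
        refine (Ctx.mentions_fill h).elim (hr.not_mentions _ _ hx) fun h => ?_
        obtain ⟨i, h⟩ := PTerm.mentions_app.1 h
        obtain ⟨c, h⟩ := PTerm.mentions_unode.1 h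
        obtain ⟨-, c', h, -⟩ := Frags.mem_project.1 h
        rw [hΨ, Finset.mem_union, Finset.mem_image] at h
        rcases h with ⟨c'', hc, h⟩ | h
        · cases h
          -- A fresh variable is not the root, which lies in the domain.
          obtain ⟨τ, h, -⟩ := hr.head
          rw [(hfresh _ hc).1] at h
          simp at h
        · exact hΦ hx _ h rfl
      · intro h
        refine (Ctx.mem_vars_fill h).elim (hr.not_mem_vars _ _ hx) fun h => ?_
        simp [PTerm.vars] at h
  | suspend₁ x x' K n Φ hx _ hx' =>
    exact hr.suspend hx fun φ hφ => hΦ hx φ (Finset.mem_insert_of_mem hφ)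
  | suspend₂ x x' K n n' Φ Φ' hx _ hx' =>
    refine hr.suspend hx fun φ hφ => ?_
    rcases Finset.mem_union.1 hφ with hφ | hφ
    · exact hΦ hx φ (Finset.mem_insert_of_mem hφ)
    · exact hΦ (K := .hole) hx' φ hφ
  | subst x₁ x₂ hx =>
    have h1 : x₁ ≠ r := by
      rintro rfl
      exact hr.not_mem_vars _ _ hx (by simp [PTerm.vars])
    refine ⟨?_, ?_, ?_⟩
    · obtain ⟨τ, h, hτ⟩ := hr.head
      have h2 : r ≠ x₂ := by
        rintro rfl
        rw [hx] at h
        cases h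
        simp at hτ
      refine ⟨_, EState.subst_eq_some.2 ⟨h2, τ, h, rfl⟩, ?_⟩
      rcases hτ with ⟨n, rfl⟩ | ⟨s, τs, rfl⟩
      · exact .inl ⟨n, rfl⟩
      · exact .inr ⟨_, _, rfl⟩
    · intro w τ' hw hm
      obtain ⟨-, τ, h, rfl⟩ := EState.subst_eq_some.1 hw
      obtain ⟨z, hz, hz'⟩ := hm.of_subst
      split_ifs at hz' with hz2
      · exact h1 hz'.symm
      · exact hr.not_mentions _ _ h (hz' ▸ hz)
    · intro w τ' hw hm
      obtain ⟨-, τ, h, rfl⟩ := EState.subst_eq_some.1 hw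
      obtain ⟨z, hz, hz'⟩ := PTerm.mem_vars_subst.1 hm
      split_ifs at hz' with hz2
      · exact h1 hz'.symm
      · exact hr.not_mem_vars _ _ h (hz' ▸ hz)

-- Soundness: reading the rules backwards

/-- A substitution that is compatible with the state after a guarded choice is compatible with the
u-node before it. -/
theorem ChooseBox.denotes {σ : EState S V} {τ τ' : PTerm S V} (h : ChooseBox True σ τ τ')
    {ρ : V → Term S} {t : Term S} (ht : τ'.Denotes ρ t) : τ.Denotes ρ t := by
  classical
  cases h with
  | mk n Φ Ψ s ch C w hmem hfresh hinj hε hΨ hdef hguard =>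
    obtain ⟨ts, rfl, hts⟩ := ht
    have key : ∀ φ ∈ Ψ, ∀ p ∈ φ.1, (Term.mk s ts).at p = some (ρ φ.2) := by
      intro φ hφ p hp
      cases p with
      | nil => exact absurd hp (hdef φ hφ)
      | cons j p =>
        -- Without the guard an out-of-range path would vanish in the projection, and its constraint
        -- with it.
        have hj := hguard trivial φ hφ j p hp
        refine Term.at_cons.2 ⟨hj, (hts ⟨j, hj⟩).2 (φ.1.project j, φ.2) ?_ p ?_⟩
        · exact Frags.mem_project.2 ⟨⟨p, PEC.mem_project.2 hp⟩, φ.1, hφ, rfl⟩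
        · exact PEC.mem_project.2 hp
    subst hΨ
    refine ⟨Node.mem_den.2 ⟨ch, C, hmem, fun i => (hts i).1, fun c hc => ⟨ρ (w c), ?_⟩⟩, ?_⟩
    · exact key (c, w c) (Finset.mem_union_left _ (Finset.mem_image_of_mem _ hc))
    · exact fun φ hφ => key φ (Finset.mem_union_right _ hφ)

-- The value at the hole must be `ρ x'`, so the trivial fragment holds by itself and the remaining
-- demands are those now attached to `x'`. The hypotheses `hn` and `hx'` isolate what differs
-- between the two suspension rules.
open Classical in
theorem EState.Compat.of_suspend {σ : EState S V} {x x' : V} {K : Ctx S V} {n m : Node S}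
    {Φ Φ' : Frags V} {ρ : V → Term S}
    (hx : σ x = some (K.fill (.unode n (insert ({[]}, x') Φ))))
    (h : EState.Compat (Function.update (Function.update σ x (some (K.fill (.var x'))))
      x' (some (.unode m Φ'))) ρ)
    (hn : (PTerm.unode m Φ').Denotes ρ (ρ x') → (PTerm.unode n Φ).Denotes ρ (ρ x'))
    (hx' : ∀ τ, σ x' = some τ → (PTerm.unode m Φ').Denotes ρ (ρ x') → τ.Denotes ρ (ρ x')) :
    σ.Compat ρ := by
  have hm : (PTerm.unode m Φ').Denotes ρ (ρ x') := h x' _ (by simp)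
  intro y τ hy
  -- This case goes first because the update at `x'` overrides the one at `x` when they coincide.
  by_cases hy' : y = x'
  · subst hy'
    exact hx' τ hy hm
  · by_cases hyx : y = x
    · subst hyx
      have h1 := h y (K.fill (.var x')) (by simp [hy'])
      obtain ⟨t₀, k, h2, h3⟩ := K.exists_hole ρ _ h1
      rw [hx] at hy
      cases hy
      refine (h3 _).1 ?_
      obtain rfl : ρ x' = t₀ := h2
      refine ⟨(hn hm).1, fun φ hφ => ?_⟩
      rcases Finset.mem_insert.1 hφ with rfl | hφ
      · simp
      · exact (hn hm).2 φ hφ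
    · exact h y τ (by simp [hy', hyx, hy])

/-- Steps do not add values of the root variable. -/
theorem Step.exists_compat {σ σ' : EState S V} (hstep : Step True σ σ') {r : V}
    (hr : σ.IsRoot r) {ρ' : V → Term S} (hρ' : σ'.Compat ρ') :
    ∃ ρ, σ.Compat ρ ∧ ρ r = ρ' r := by
  classical
  cases hstep with
  | choose x K τ τ' hx hτ hs =>
    refine ⟨ρ', fun y τ₁ hy => ?_, rfl⟩
    by_cases hyx : y = x
    · subst hyx
      obtain ⟨t₀, k, h1, h2⟩ := K.exists_hole ρ' _ (hρ' y (K.fill τ') (by simp))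
      rw [hx] at hy
      cases hy
      exact (h2 _).1 (hτ.denotes h1)
    · exact hρ' y τ₁ (by simp [hyx, hy])
  | suspend₁ x x' K n Φ hx _ hx' =>
    exact ⟨ρ', hρ'.of_suspend hx id (by simp [hx']), rfl⟩
  | suspend₂ x x' K n n' Φ Φ' hx _ hx' =>
    refine ⟨ρ', hρ'.of_suspend hx (fun h => ?_) (fun τ hτ h => ?_), rfl⟩
    · exact ⟨(Node.mem_den_inter.1 h.1).1, fun φ hφ => h.2 φ (Finset.mem_union_left _ hφ)⟩
    · rw [hx'] at hτ
      cases hτ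
      exact ⟨(Node.mem_den_inter.1 h.1).2, fun φ hφ => h.2 φ (Finset.mem_union_right _ hφ)⟩
  | subst x₁ x₂ hx =>
    have hr2 : r ≠ x₂ := by
      rintro rfl
      obtain ⟨τ, h, hτ⟩ := hr.head
      rw [hx] at h
      cases h
      simp at hτ
    -- The eliminated variable takes the value of its replacement; for `x₁ = x₂` nothing changes.
    set ρ := Function.update ρ' x₂ (ρ' x₁) with hρ
    have hρ1 : ρ x₁ = ρ' x₁ := by
      by_cases h : x₁ = x₂
      · rw [hρ, h, Function.update_self]
      · rw [hρ, Function.update_of_ne h]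
    have hρ2 : ρ x₂ = ρ x₁ := by rw [hρ1, hρ, Function.update_self]
    have hsub : ∀ z, ρ z = ρ' (if z = x₂ then x₁ else z) := by
      intro z
      split_ifs with hz
      · rw [hz, hρ2, hρ1]
      · rw [hρ, Function.update_of_ne hz]
    have key : ∀ (τ : PTerm S V) (t : Term S), (τ.subst x₁ x₂).Denotes ρ' t →
        τ.Denotes ρ t := by
      intro τ
      induction τ with
      | var z => intro t h; simpa only [PTerm.subst, PTerm.Denotes, hsub z] using h
      | app s τs ih =>
        rintro t ⟨ts, rfl, h⟩
        exact ⟨ts, rfl, fun i => ih i _ (h i)⟩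
      | unode n Φ =>
        intro t h
        simpa only [PTerm.subst, PTerm.Denotes, Finset.forall_mem_image, ← hsub] using h
    refine ⟨ρ, fun y τ hy => ?_, by rw [hρ, Function.update_of_ne hr2]⟩
    by_cases hy2 : y = x₂
    · subst hy2
      rw [hx] at hy
      cases hy
      exact hρ2.symm
    · rw [hρ, Function.update_of_ne hy2, ← hρ]
      exact key _ _ (hρ' y _ (EState.subst_eq_some.2 ⟨hy2, τ, hy, rfl⟩))

theorem enumerated_subset_den (vtop : V) (n : Node S) : enumerated True vtop n ⊆ n.den := by
  classical
  rintro t ⟨σ, hσ, -, r, ⟨ρ, hρ, rfl⟩, ht⟩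
  -- Quantifying over all `ρ'` lets the backward steps compose along the run.
  have key : σ.IsRoot vtop ∧ ∀ ρ' : V → Term S, σ.Compat ρ' →
      ∃ ρ, (EState.init vtop n).Compat ρ ∧ ρ vtop = ρ' vtop := by
    clear hρ ht
    induction hσ with
    | refl => exact ⟨EState.isRoot_init vtop n, fun ρ' h => ⟨ρ', h, rfl⟩⟩
    | tail _ hs ih =>
      refine ⟨hs.isRoot ih.1, fun ρ' h => ?_⟩
      obtain ⟨ρ₁, h1, h1'⟩ := hs.exists_compat ih.1 h
      obtain ⟨ρ₂, h2, h2'⟩ := ih.2 ρ₁ h1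
      exact ⟨ρ₂, h2, h2'.trans h1'⟩
  obtain ⟨ρ₀, h1, h2⟩ := key.2 ρ fun x τ hx => (hρ x τ hx).denotes
  obtain ⟨τ, hτ, -⟩ := key.1.head
  simp only [hτ, Option.map_some, Option.some.injEq] at ht
  subst ht
  rw [← h2]
  exact (h1 vtop (.unode n ∅) (by simp [EState.init])).1

-- Redundancy of the guard for paths in range

/-- All u-nodes of `σ` have their own constraint paths and those of their fragments in range. -/
def EState.AllInRange (σ : EState S V) : Prop :=
  ∀ w τ n Φ, σ w = some τ → (n, Φ) ∈ τ.unodes →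
    n.PathsInRange ∧ ∀ φ ∈ Φ, ∀ p ∈ φ.1, n.InRange p

open Classical in
theorem EState.AllInRange.update {σ : EState S V} (h : σ.AllInRange) {x : V} {τ : PTerm S V}
    (hτ : ∀ n Φ, (n, Φ) ∈ τ.unodes → n.PathsInRange ∧ ∀ φ ∈ Φ, ∀ p ∈ φ.1, n.InRange p) :
    EState.AllInRange (Function.update σ x (some τ)) := by
  intro w τ' n Φ hw hn
  rcases EState.update_eq_some.1 hw with ⟨-, rfl⟩ | ⟨-, hw⟩
  · exact hτ n Φ hn
  · exact h w τ' n Φ hw hn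

/-- Being in range speaks about all transitions of the node, in particular the chosen one; this
yields the guard and passes the tails of the paths to the children. -/
theorem ChooseBox.inRange {g : Prop} {σ : EState S V} {n : Node S} {Φ : Frags V}
    {τ' : PTerm S V} (h : ChooseBox g σ (.unode n Φ) τ') (hn : n.PathsInRange)
    (hΦ : ∀ φ ∈ Φ, ∀ p ∈ φ.1, n.InRange p) :
    ChooseBox True σ (.unode n Φ) τ' ∧ ∀ m Φ', (m, Φ') ∈ τ'.unodes →
      m.PathsInRange ∧ ∀ φ ∈ Φ', ∀ p ∈ φ.1, m.InRange p := by
  classical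
  cases h with
  | mk _ _ Ψ s ch C w hmem hfresh hinj hε hΨ hdef hguard =>
    have key : ∀ φ ∈ Ψ, ∀ j p, j :: p ∈ φ.1 →
        ∃ h : j < S.arity s, (ch ⟨j, h⟩).InRange p := by
      intro φ hφ j p hp
      rw [hΨ, Finset.mem_union, Finset.mem_image] at hφ
      rcases hφ with ⟨c, hc, rfl⟩ | hφ
      · exact Node.inRange_singleton.1 (hn s ch C (.here hmem) c hc _ hp)
      · exact hΦ φ hφ _ hp s ch C hmem
    refine ⟨.mk n Φ Ψ s ch C w hmem hfresh hinj hε hΨ hdef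
      fun _ φ hφ j p hp => (key φ hφ j p hp).1, fun m Φ' hm => ?_⟩
    simp only [PTerm.unodes, Set.mem_iUnion, Set.mem_singleton_iff, Prod.mk.injEq] at hm
    obtain ⟨i, rfl, rfl⟩ := hm
    refine ⟨hn.child hmem i, fun φ hφ p hp => ?_⟩
    obtain ⟨-, c, hc, hφ⟩ := Frags.mem_project.1 hφ
    rw [hφ] at hp
    exact (key _ hc i p (PEC.mem_project.1 hp)).2

open Classical in
theorem EState.AllInRange.suspend {σ : EState S V} (h : σ.AllInRange) {x x' : V} {K : Ctx S V}
    {τ : PTerm S V} {m : Node S} {Φ : Frags V} (hx : σ x = some (K.fill τ))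
    (hm : m.PathsInRange) (hΦ : ∀ φ ∈ Φ, ∀ p ∈ φ.1, m.InRange p) :
    EState.AllInRange (Function.update (Function.update σ x (some (K.fill (.var x'))))
      x' (some (.unode m Φ))) := by
  refine EState.AllInRange.update (h.update fun n Ψ hn => ?_) fun n Ψ hn => ?_
  · rcases Ctx.mem_unodes_fill hn with hn | hn
    · exact h x _ n Ψ hx hn
    · simp [PTerm.unodes] at hn
  · simp only [PTerm.unodes, Set.mem_singleton_iff, Prod.mk.injEq] at hn
    obtain ⟨rfl, rfl⟩ := hn
    exact ⟨hm, hΦ⟩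

/-- Where all paths are in range, the guard of the choice rule is redundant. -/
theorem Step.guarded {g : Prop} {σ σ' : EState S V} (hstep : Step g σ σ') (h : σ.AllInRange) :
    Step True σ σ' ∧ σ'.AllInRange := by
  classical
  cases hstep with
  | choose x K τ τ' hx hτ hs =>
    have hτ' := hτ
    obtain ⟨n, Φ, Ψ, s, ch, C, w, hmem, hfresh, hinj, hε, hΨ, hdef, hguard⟩ := hτ'
    obtain ⟨h1, h2⟩ := h x _ n Φ hx (K.mem_unodes_fill_self n _)
    obtain ⟨h3, h4⟩ := hτ.inRange h1 h2
    refine ⟨.choose σ x K _ _ hx h3 hs, h.update fun m Φ' hm => ?_⟩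
    rcases Ctx.mem_unodes_fill hm with hm | hm
    · exact h x _ m Φ' hx hm
    · exact h4 m Φ' hm
  | suspend₁ x x' K n Φ hx hΦ hx' =>
    obtain ⟨h1, h2⟩ := h x _ n _ hx (K.mem_unodes_fill_self n _)
    exact ⟨.suspend₁ σ x x' K n Φ hx hΦ hx', h.suspend hx h1
      fun φ hφ => h2 φ (Finset.mem_insert_of_mem hφ)⟩
  | suspend₂ x x' K n n' Φ Φ' hx hΦ hx' =>
    obtain ⟨h1, h2⟩ := h x _ n _ hx (K.mem_unodes_fill_self n _)
    obtain ⟨h3, h4⟩ := h x' _ n' Φ' hx' (by simp [PTerm.unodes])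
    refine ⟨.suspend₂ σ x x' K n n' Φ Φ' hx hΦ hx', h.suspend hx (h1.inter h3)
      fun φ hφ p hp => ?_⟩
    rcases Finset.mem_union.1 hφ with hφ | hφ
    · exact (h2 φ (Finset.mem_insert_of_mem hφ) p hp).inter_left
    · exact (h4 φ hφ p hp).inter_right
  | subst x₁ x₂ hx =>
    refine ⟨.subst σ x₁ x₂ hx, fun w τ' n Φ' hw' hn' => ?_⟩
    obtain ⟨-, τ, hw, rfl⟩ := EState.subst_eq_some.1 hw'
    obtain ⟨Φ, hn, rfl⟩ := PTerm.mem_unodes_subst.1 hn'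
    obtain ⟨h1, h2⟩ := h w τ n Φ hw hn
    exact ⟨h1, by simpa only [Finset.forall_mem_image] using fun φ hφ => h2 φ hφ⟩

theorem Step.unguarded {σ σ' : EState S V} (hstep : Step True σ σ') :
    Step False σ σ' := by
  cases hstep with
  | choose x K τ τ' hx hτ hs =>
    refine .choose σ x K _ _ hx ?_ hs
    obtain ⟨n, Φ, Ψ, s, ch, C, w, hmem, hfresh, hinj, hε, hΨ, hdef, hguard⟩ := hτ
    exact .mk n Φ Ψ s ch C w hmem hfresh hinj hε hΨ hdef False.elim
  | suspend₁ x x' K n Φ hx hΦ hx' => exact .suspend₁ σ x x' K n Φ hx hΦ hx'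
  | suspend₂ x x' K n n' Φ Φ' hx hΦ hx' => exact .suspend₂ σ x x' K n n' Φ Φ' hx hΦ hx'
  | subst x₁ x₂ hx => exact .subst σ x₁ x₂ hx

theorem enumerated_unguarded (vtop : V) {n : Node S} (hn : n.PathsInRange) :
    enumerated False vtop n = enumerated True vtop n := by
  classical
  have init : (EState.init vtop n).AllInRange := by
    refine EState.AllInRange.update (fun _ _ _ _ h => by simp at h) fun m Φ hm => ?_
    simp only [PTerm.unodes, Set.mem_singleton_iff, Prod.mk.injEq] at hm
    obtain ⟨rfl, rfl⟩ := hm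
    exact ⟨hn, by simp⟩
  ext t
  constructor
  · rintro ⟨σ, hσ, h⟩
    refine ⟨σ, ?_, h⟩
    suffices Relation.ReflTransGen (Step True) (EState.init vtop n) σ ∧ σ.AllInRange from this.1
    clear h
    induction hσ with
    | refl => exact ⟨.refl, init⟩
    | tail _ hs ih =>
      obtain ⟨h1, h2⟩ := hs.guarded ih.2
      exact ⟨ih.1.tail h1, h2⟩
  · rintro ⟨σ, hσ, h⟩
    exact ⟨σ, Relation.ReflTransGen.mono (fun _ _ hs => hs.unguarded) _ _ hσ, h⟩

-- Completeness: invariants and measure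

/-- Used when fresh variables receive values: they do not occur in the old state. -/
theorem PTerm.Denotes.congr {ρ ρ' : V → Term S} {τ : PTerm S V} :
    ∀ {t : Term S}, τ.Denotes ρ t → (∀ y ∈ τ.vars, ρ' y = ρ y) →
      (∀ y, τ.Mentions y → ρ' y = ρ y) → τ.Denotes ρ' t := by
  induction τ with
  | var x => intro t h h1 _; exact (h1 x (by simp [PTerm.vars])).trans h
  | app s τs ih =>
    rintro _ ⟨ts, rfl, h⟩ h1 h2
    refine ⟨ts, rfl, fun i => ih i (h i) (fun y hy => h1 y ?_) fun y hy => h2 y ?_⟩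
    · exact Set.mem_iUnion.2 ⟨i, hy⟩
    · exact PTerm.mentions_app.2 ⟨i, hy⟩
  | unode n Φ =>
    rintro t ⟨h, hΦ⟩ _ h2
    refine ⟨h, fun φ hφ p hp => ?_⟩
    rw [h2 φ.2 (PTerm.mentions_unode.2 ⟨φ.1, hφ⟩)]
    exact hΦ φ hφ p hp

theorem PTerm.Denotes.exists_of_mem_unodes {ρ : V → Term S} {τ : PTerm S V} {n : Node S}
    {Φ : Frags V} : ∀ {t : Term S}, τ.Denotes ρ t → (n, Φ) ∈ τ.unodes →
      ∃ t₀ : Term S, t₀.size ≤ t.size ∧ (PTerm.unode n Φ).Denotes ρ t₀ := by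
  induction τ with
  | var x => simp [PTerm.unodes]
  | app s τs ih =>
    rintro _ ⟨ts, rfl, h⟩ hu
    simp only [PTerm.unodes, Set.mem_iUnion] at hu
    obtain ⟨i, hu⟩ := hu
    obtain ⟨t₀, h1, h2⟩ := ih i (h i) hu
    exact ⟨t₀, h1.trans (Term.size_lt_mk s ts i).le, h2⟩
  | unode n' Φ' =>
    rintro t h hu
    simp only [PTerm.unodes, Set.mem_singleton_iff, Prod.mk.injEq] at hu
    obtain ⟨rfl, rfl⟩ := hu
    exact ⟨t, le_rfl, h⟩

/-- No u-node of the p-term carries a fragment with the trivial class. -/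
def PTerm.TrivialFree (τ : PTerm S V) : Prop :=
  ∀ n Φ, (n, Φ) ∈ τ.unodes → ∀ x, (({[]} : PEC), x) ∉ Φ

theorem PTerm.TrivialFree.subst {τ : PTerm S V} (h : τ.TrivialFree) (x y : V) :
    (τ.subst y x).TrivialFree := by
  classical
  intro n Ψ hu z hz
  obtain ⟨Φ, h1, rfl⟩ := PTerm.mem_unodes_subst.1 hu
  obtain ⟨⟨c, w⟩, h3, h4⟩ := Finset.mem_image.1 hz
  cases h4
  exact h n Φ h1 _ h3

theorem PTerm.trivialFree_unode {n : Node S} {Φ : Frags V} :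
    (PTerm.unode n Φ).TrivialFree ↔ ∀ x, (({[]} : PEC), x) ∉ Φ := by
  constructor
  · exact fun h => h n Φ (by simp [PTerm.unodes])
  · intro h n' Φ' hu
    simp only [PTerm.unodes, Set.mem_singleton_iff, Prod.mk.injEq] at hu
    obtain ⟨rfl, rfl⟩ := hu
    exact h

/-- The weight of the component of `x`, zero when `x` is not in the domain. -/
def EState.weightAt (σ : EState S V) (ρ : V → Term S) (x : V) : ℕ :=
  (σ x).elim 0 fun τ => τ.weight (ρ x)

theorem EState.weightAt_of_some {σ : EState S V} {ρ : V → Term S} {x : V} {τ : PTerm S V}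
    (h : σ x = some τ) : σ.weightAt ρ x = τ.weight (ρ x) := by
  simp [EState.weightAt, h]

theorem EState.weightAt_of_none {σ : EState S V} {ρ : V → Term S} {x : V}
    (h : σ x = none) : σ.weightAt ρ x = 0 := by
  simp [EState.weightAt, h]

/-- The total weight of the components of the variables in `D`. -/
def EState.weight (σ : EState S V) (ρ : V → Term S) (D : Finset V) : ℕ :=
  ∑ x ∈ D, σ.weightAt ρ x

/-- `σ` is compatible with `ρ`, uses only variables in `D`, and is well-formed. -/
structure EState.Inv (σ : EState S V) (ρ : V → Term S) (D : Finset V) (r : V) : Prop where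
  compat : σ.Compat ρ
  closed : ∀ x τ, σ x = some τ → ∀ y ∈ τ.vars, σ y ≠ none
  node : ∀ x τ, σ x = some τ → ∀ n Φ, (n, Φ) ∈ τ.unodes →
    n.NoTrivialPEC ∧ ∀ φ ∈ Φ, φ.1.Nonempty
  fresh : ∀ x, x ∉ D → σ.Fresh x
  root_ne : σ r ≠ none
  root : ∀ x τ, σ x = some τ → ¬ τ.Mentions r

/-- No variable is bound to a variable, and a variable that a fragment mentions is unbound or bound
to a u-node. -/
structure EState.Tidy (σ : EState S V) : Prop where
  ne_var : ∀ x y, σ x ≠ some (.var y)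
  mentions : ∀ x τ, σ x = some τ → ∀ y, τ.Mentions y →
    σ y = none ∨ ∃ n Φ, σ y = some (.unode n Φ)

/-- The variable `x` is bound to an application and no fragment mentions it. -/
structure EState.Rigid (σ : EState S V) (x : V) : Prop where
  app : ∃ s τs, σ x = some (.app s τs)
  not_mentions : ∀ w τ, σ w = some τ → ¬ τ.Mentions x

theorem EState.Inv.mem_of_some {σ : EState S V} {ρ : V → Term S} {D : Finset V} {r : V}
    (h : σ.Inv ρ D r) {x : V} (hx : σ x ≠ none) : x ∈ D := by
  by_contra hD
  exact hx (h.fresh x hD).1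

theorem EState.Inv.mem_of_mentions {σ : EState S V} {ρ : V → Term S} {D : Finset V} {r : V}
    (h : σ.Inv ρ D r) {x y : V} {τ : PTerm S V} (hx : σ x = some τ) (hy : τ.Mentions y) :
    y ∈ D := by
  by_contra hD
  exact (h.fresh y hD).2.1 (EState.mentions_iff.2 ⟨x, τ, hx, hy⟩)

theorem EState.Inv.mem_of_mem_vars {σ : EState S V} {ρ : V → Term S} {D : Finset V} {r : V}
    (h : σ.Inv ρ D r) {x y : V} {τ : PTerm S V} (hx : σ x = some τ) (hy : y ∈ τ.vars) :
    y ∈ D :=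
  h.mem_of_some (h.closed x τ hx y hy)

/-- Freshness of the variables outside `D` from membership in `D` of all that occur. -/
theorem EState.fresh_of_mem {σ : EState S V} {D : Finset V} (h1 : ∀ x, σ x ≠ none → x ∈ D)
    (h2 : ∀ x τ, σ x = some τ → ∀ y, τ.Mentions y → y ∈ D)
    (h3 : ∀ x τ, σ x = some τ → ∀ y ∈ τ.vars, σ y ≠ none) (x : V) (hx : x ∉ D) :
    σ.Fresh x := by
  refine ⟨by_contra fun h => hx (h1 x h), fun h => ?_, fun w τ hw h => hx (h1 x (h3 w τ hw x h))⟩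
  obtain ⟨w, τ, hw, h⟩ := EState.mentions_iff.1 h
  exact hx (h2 w τ hw x h)

-- Completeness: removing trivial fragments

open Classical in
/-- A u-node with a trivial fragment can be suspended, without losing the substitution. -/
theorem EState.Inv.exists_suspend {σ : EState S V} {ρ : V → Term S} {D : Finset V} {r : V}
    (hσ : σ.Inv ρ D r) {x v : V} {K : Ctx S V} {n : Node S} {Φ : Frags V}
    (hx : σ x = some (K.fill (.unode n Φ))) (hv : (({[]} : PEC), v) ∈ Φ) (hxv : x ≠ v)
    (hσv : σ v = none ∨ ∃ n' Φ', σ v = some (.unode n' Φ')) :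
    ∃ m Φ', ∀ σ' : EState S V, σ' = Function.update (Function.update σ x (some (K.fill (.var v)))) v
        (some (.unode m Φ')) →
      Step True σ σ' ∧ σ'.Inv ρ D r ∧ σ'.weight ρ D ≤ σ.weight ρ D ∧
      σ'.weightAt ρ x < σ.weightAt ρ x ∧
      (∀ φ ∈ Φ', (φ ∈ Φ ∧ φ ≠ ({[]}, v)) ∨ ∃ n' Ψ, σ v = some (.unode n' Ψ) ∧ φ ∈ Ψ) ∧
      ∀ w τ, σ' w = some τ → ∀ y, τ.Mentions y → ∃ w' τ', σ w' = some τ' ∧ τ'.Mentions y := by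
  obtain ⟨hn, hΦ⟩ := hσ.node x _ hx n Φ (K.mem_unodes_fill_self n Φ)
  have hΦm : ∀ φ ∈ Φ, (K.fill (.unode n Φ)).Mentions φ.2 := fun φ hφ =>
    K.mentions_fill_of_mentions (PTerm.mentions_unode.2 ⟨φ.1, hφ⟩)
  obtain ⟨t₀, k, h0, hK⟩ := K.exists_hole ρ _ (hσ.compat x _ hx)
  -- The trivial fragment forces the value at the hole.
  obtain rfl : t₀ = ρ v := by simpa using h0.2 _ hv [] (by simp)
  have hins : insert (({[]} : PEC), v) (Φ.erase ({[]}, v)) = Φ := Finset.insert_erase hv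
  obtain ⟨m, Φ', hstep, hden, hm, hΦ'⟩ : ∃ m Φ', Step True σ (Function.update
      (Function.update σ x (some (K.fill (.var v)))) v (some (.unode m Φ'))) ∧
      ρ v ∈ m.den ∧ m.NoTrivialPEC ∧
      ∀ φ ∈ Φ', (φ ∈ Φ ∧ φ ≠ ({[]}, v)) ∨ ∃ n' Ψ, σ v = some (.unode n' Ψ) ∧ φ ∈ Ψ := by
    rcases hσv with hσv | ⟨n', Ψ, hσv⟩
    · exact ⟨n, Φ.erase ({[]}, v), .suspend₁ σ x v K n _ (by rw [hins, hx]) (by simp) hσv, h0.1,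
        hn, fun φ hφ => .inl ((Finset.mem_erase.1 hφ).symm)⟩
    · obtain ⟨hn', -⟩ := hσ.node v _ hσv n' Ψ (by simp [PTerm.unodes])
      refine ⟨n.inter n', Φ.erase ({[]}, v) ∪ Ψ, .suspend₂ σ x v K n n' _ Ψ (by rw [hins, hx])
        (by simp) hσv, Node.mem_den_inter.2 ⟨h0.1, (hσ.compat v _ hσv).1⟩, hn.inter hn',
        fun φ hφ => ?_⟩
      rcases Finset.mem_union.1 hφ with hφ | hφ
      · exact .inl ((Finset.mem_erase.1 hφ).symm)
      · exact .inr ⟨n', Ψ, hσv, hφ⟩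
  refine ⟨m, Φ', fun σ' hσ' => ?_⟩
  have hσ'v : σ' v = some (.unode m Φ') := by simp [hσ']
  have hσ'x : σ' x = some (K.fill (.var v)) := by simp [hσ', hxv]
  have hσ'y : ∀ y, y ≠ x → y ≠ v → σ' y = σ y := fun y h1 h2 => by simp [hσ', h1, h2]
  have cases' : ∀ w τ, σ' w = some τ → (w = v ∧ τ = .unode m Φ') ∨
      (w = x ∧ τ = K.fill (.var v)) ∨ (w ≠ v ∧ w ≠ x ∧ σ w = some τ) := by
    intro w τ hw
    rw [hσ'] at hw
    rcases EState.update_eq_some.1 hw with h | ⟨h1, h⟩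
    · exact .inl h
    · rcases EState.update_eq_some.1 h with h | ⟨h2, h⟩
      · exact .inr (.inl h)
      · exact .inr (.inr ⟨h1, h2, h⟩)
  have hment : ∀ w τ, σ' w = some τ → ∀ y, τ.Mentions y →
      ∃ w' τ', σ w' = some τ' ∧ τ'.Mentions y := by
    intro w τ hw y hy
    rcases cases' w τ hw with ⟨rfl, rfl⟩ | ⟨rfl, rfl⟩ | ⟨-, -, h⟩
    · obtain ⟨c, hc⟩ := PTerm.mentions_unode.1 hy
      rcases hΦ' _ hc with ⟨hc, -⟩ | ⟨n', Ψ, h1, h2⟩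
      · exact ⟨x, _, hx, hΦm _ hc⟩
      · exact ⟨w, _, h1, PTerm.mentions_unode.2 ⟨c, h2⟩⟩
    · rcases Ctx.mentions_fill hy with hy | hy
      · exact ⟨w, _, hx, hy⟩
      · exact absurd hy PTerm.not_mentions_var
    · exact ⟨w, τ, h, hy⟩
  have hdom : ∀ y, σ y ≠ none → σ' y ≠ none := by
    intro y hy
    by_cases h1 : y = v
    · simp [h1, hσ'v]
    · by_cases h2 : y = x
      · simp [h2, hσ'x]
      · rwa [hσ'y y h2 h1]
  have hclosed : ∀ x τ, σ' x = some τ → ∀ y ∈ τ.vars, σ' y ≠ none := by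
    intro w τ hw y hy
    rcases cases' w τ hw with ⟨rfl, rfl⟩ | ⟨rfl, rfl⟩ | ⟨-, -, h⟩
    · simp [PTerm.vars] at hy
    · rcases Ctx.mem_vars_fill hy with hy | hy
      · exact hdom _ (hσ.closed w _ hx y hy)
      · obtain rfl : y = v := by simpa [PTerm.vars] using hy
        simp [hσ'v]
    · exact hdom _ (hσ.closed w τ h y hy)
  have hvD : v ∈ D := hσ.mem_of_mentions hx (hΦm _ hv)
  have hxD : x ∈ D := hσ.mem_of_some (by simp [hx])
  have hwx : σ'.weightAt ρ x = k := by
    rw [EState.weightAt_of_some hσ'x, (hK _).2]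
    rfl
  have hwx' : σ.weightAt ρ x = k + (ρ v).size := by
    rw [EState.weightAt_of_some hx, (hK _).2]
    rfl
  have hwv : σ'.weightAt ρ v = (ρ v).size := by
    rw [EState.weightAt_of_some hσ'v]
    rfl
  refine ⟨hσ' ▸ hstep, ⟨?_, hclosed, ?_, EState.fresh_of_mem ?_ ?_ hclosed,
    hdom r hσ.root_ne, ?_⟩, ?_, ?_, hΦ', hment⟩
  · intro w τ hw
    rcases cases' w τ hw with ⟨rfl, rfl⟩ | ⟨rfl, rfl⟩ | ⟨-, -, h⟩
    · refine ⟨hden, fun φ hφ => ?_⟩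
      rcases hΦ' φ hφ with ⟨hφ, -⟩ | ⟨n', Ψ, h1, h2⟩
      · exact h0.2 φ hφ
      · exact (hσ.compat w _ h1).2 φ h2
    · exact (hK _).1 rfl
    · exact hσ.compat w τ h
  · intro w τ hw n₁ Φ₁ hu
    rcases cases' w τ hw with ⟨rfl, rfl⟩ | ⟨rfl, rfl⟩ | ⟨-, -, h⟩
    · simp only [PTerm.unodes, Set.mem_singleton_iff, Prod.mk.injEq] at hu
      obtain ⟨rfl, rfl⟩ := hu
      refine ⟨hm, fun φ hφ => ?_⟩
      rcases hΦ' φ hφ with ⟨hφ, -⟩ | ⟨n', Ψ, h1, h2⟩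
      · exact hΦ φ hφ
      · exact (hσ.node w _ h1 n' Ψ (by simp [PTerm.unodes])).2 φ h2
    · rcases Ctx.mem_unodes_fill hu with hu | hu
      · exact hσ.node w _ hx n₁ Φ₁ hu
      · simp [PTerm.unodes] at hu
    · exact hσ.node w τ h n₁ Φ₁ hu
  · intro y hy
    by_cases h1 : y = v
    · rwa [h1]
    · by_cases h2 : y = x
      · rwa [h2]
      · rw [hσ'y y h2 h1] at hy
        exact hσ.mem_of_some hy
  · intro w τ hw y hy
    obtain ⟨w', τ', h1, h2⟩ := hment w τ hw y hy
    exact hσ.mem_of_mentions h1 h2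
  · intro w τ hw hy
    obtain ⟨w', τ', h1, h2⟩ := hment w τ hw r hy
    exact hσ.root w' τ' h1 h2
  -- The term at the hole moves from `x` to `v`: the component of `x` loses `(ρ v).size`, and that
  -- of `v` weighs exactly this much afterwards, whether or not `v` was bound before.
  · have hvD' : v ∈ D.erase x := Finset.mem_erase.2 ⟨hxv.symm, hvD⟩
    rw [EState.weight, EState.weight, ← Finset.add_sum_erase _ _ hxD,
      ← Finset.add_sum_erase _ _ hvD', ← Finset.add_sum_erase _ (fun y => σ.weightAt ρ y) hxD,
      ← Finset.add_sum_erase _ (fun y => σ.weightAt ρ y) hvD', hwx, hwx', hwv]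
    have : ∑ y ∈ (D.erase x).erase v, σ'.weightAt ρ y =
        ∑ y ∈ (D.erase x).erase v, σ.weightAt ρ y := by
      refine Finset.sum_congr rfl fun y hy => ?_
      simp only [Finset.mem_erase] at hy
      simp only [EState.weightAt, hσ'y y hy.2.1 hy.1]
    omega
  · rw [hwx, hwx']
    have := (ρ v).size_pos
    omega

open Classical in
/-- A variable that is bound to another variable can be eliminated. -/
theorem EState.Inv.subst {σ : EState S V} {ρ : V → Term S} {D : Finset V} {r : V}
    (hσ : σ.Inv ρ D r) {x y : V} (hx : σ x = some (.var y)) (hxy : x ≠ y) (hxr : x ≠ r)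
    (hyr : y ≠ r) {σ' : EState S V}
    (hσ' : σ' = fun z => (Function.update σ x none z).map (PTerm.subst y x)) :
    σ'.Inv ρ D r ∧ σ'.weight ρ D ≤ σ.weight ρ D := by
  have hρ : ρ x = ρ y := (hσ.compat x _ hx).symm
  have hsome : ∀ w τ', σ' w = some τ' → w ≠ x ∧ ∃ τ, σ w = some τ ∧ τ' = τ.subst y x := by
    intro w τ' h
    rw [hσ'] at h
    exact EState.subst_eq_some.1 h
  have hdom : ∀ w, w ≠ x → (σ' w = none ↔ σ w = none) := fun w hw => by simp [hσ', hw]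
  have hy : σ y ≠ none := hσ.closed x _ hx y (by simp [PTerm.vars])
  have hclosed : ∀ x τ, σ' x = some τ → ∀ y ∈ τ.vars, σ' y ≠ none := by
    intro w τ' hw z hz
    obtain ⟨-, τ, h, rfl⟩ := hsome w τ' hw
    obtain ⟨z', hz', rfl⟩ := PTerm.mem_vars_subst.1 hz
    split_ifs with hzx
    · rwa [Ne, hdom y hxy.symm]
    · rw [Ne, hdom z' hzx]
      exact hσ.closed w τ h z' hz'
  refine ⟨⟨?_, hclosed, ?_, EState.fresh_of_mem ?_ ?_ hclosed, ?_, ?_⟩, ?_⟩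
  · intro w τ' hw
    obtain ⟨-, τ, h, rfl⟩ := hsome w τ' hw
    exact (PTerm.denotes_subst hρ).2 (hσ.compat w τ h)
  · intro w τ' hw n Ψ hu
    obtain ⟨-, τ, h, rfl⟩ := hsome w τ' hw
    obtain ⟨Φ, hu', rfl⟩ := PTerm.mem_unodes_subst.1 hu
    refine ⟨(hσ.node w τ h n Φ hu').1, ?_⟩
    simpa only [Finset.forall_mem_image] using (hσ.node w τ h n Φ hu').2
  · intro w hw
    obtain ⟨τ', hw⟩ := Option.ne_none_iff_exists'.1 hw
    obtain ⟨-, τ, h, rfl⟩ := hsome w τ' hw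
    exact hσ.mem_of_some (by simp [h])
  · intro w τ' hw z hz
    obtain ⟨-, τ, h, rfl⟩ := hsome w τ' hw
    obtain ⟨z', hz', rfl⟩ := hz.of_subst
    split_ifs with hzx
    · exact hσ.mem_of_some hy
    · exact hσ.mem_of_mentions h hz'
  · rw [Ne, hdom r hxr.symm]
    exact hσ.root_ne
  · intro w τ' hw hz
    obtain ⟨-, τ, h, rfl⟩ := hsome w τ' hw
    obtain ⟨z', hz', hr⟩ := hz.of_subst
    split_ifs at hr with hzx
    · exact hyr hr.symm
    · exact hσ.root w τ h (hr ▸ hz')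
  · refine Finset.sum_le_sum fun w _ => ?_
    rcases hw : σ' w with _ | τ'
    · rw [EState.weightAt_of_none hw]
      exact Nat.zero_le _
    · obtain ⟨-, τ, h, rfl⟩ := hsome w τ' hw
      rw [EState.weightAt_of_some hw, EState.weightAt_of_some h, PTerm.weight_subst]

open Classical in
/-- The trivial fragments of a u-node that is bound to a variable can be eliminated by unifying
variables. -/
theorem EState.Inv.exists_unify {ρ : V → Term S} {D : Finset V} {r x : V} (k : ℕ) :
    ∀ {σ : EState S V}, σ.Inv ρ D r → σ.Tidy → σ.Rigid x → ∀ {v n} {Φ : Frags V},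
      σ v = some (.unode n Φ) → v ≠ r → (({[]} : PEC), v) ∉ Φ →
      (∀ w τ, σ w = some τ → w ≠ x → w ≠ v → τ.TrivialFree) →
      (Φ.filter fun φ => φ.1 = {[]}).card ≤ k →
      ∃ σ', Relation.ReflTransGen (Step True) σ σ' ∧ σ'.Inv ρ D r ∧ σ'.Tidy ∧ σ'.Rigid x ∧
        (∀ w τ, σ' w = some τ → w ≠ x → τ.TrivialFree) ∧
        σ'.weight ρ D ≤ σ.weight ρ D ∧ σ'.weightAt ρ x = σ.weightAt ρ x := by
  induction k with
  | zero =>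
    intro σ hσ ht hR v n Φ hv hvr hvΦ hfree hk
    refine ⟨σ, .refl, hσ, ht, hR, fun w τ hw hwx => ?_, le_rfl, rfl⟩
    by_cases hwv : w = v
    · subst hwv
      rw [hv] at hw
      cases hw
      refine PTerm.trivialFree_unode.2 fun u hu => ?_
      have hmem : (({[]} : PEC), u) ∈ Φ.filter fun φ => φ.1 = {[]} :=
        Finset.mem_filter.2 ⟨hu, rfl⟩
      have := Finset.card_pos.2 ⟨_, hmem⟩
      omega
    · exact hfree w τ hw hwx hwv
  | succ k ih =>
    intro σ hσ ht hR v n Φ hv hvr hvΦ hfree hk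
    by_cases hu : ∃ u, (({[]} : PEC), u) ∈ Φ
    swap
    · refine ⟨σ, .refl, hσ, ht, hR, fun w τ hw hwx => ?_, le_rfl, rfl⟩
      by_cases hwv : w = v
      · subst hwv
        rw [hv] at hw
        cases hw
        exact PTerm.trivialFree_unode.2 fun u h => hu ⟨u, h⟩
      · exact hfree w τ hw hwx hwv
    -- Suspending the whole component of `v` binds `v` to `u`; eliminating `v` then moves the
    -- problem to `u`, with at least one trivial fragment fewer.
    obtain ⟨u, hu⟩ := hu
    have humen : (PTerm.unode n Φ).Mentions u := PTerm.mentions_unode.2 ⟨_, hu⟩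
    have hvu : v ≠ u := by
      rintro rfl
      exact hvΦ hu
    have hux : u ≠ x := by
      rintro rfl
      exact hR.not_mentions _ _ hv humen
    have hur : u ≠ r := by
      rintro rfl
      exact hσ.root _ _ hv humen
    have hvx : v ≠ x := by
      rintro rfl
      obtain ⟨s, τs, h⟩ := hR.app
      rw [hv] at h
      cases h
    obtain ⟨m, Φ', h⟩ := hσ.exists_suspend (K := .hole) hv hu hvu (ht.mentions _ _ hv u humen)
    obtain ⟨hstep, hσ₁, hW, -, hΦ', hment⟩ := h _ rfl
    set σ₁ : EState S V := Function.update (Function.update σ v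
      (some (Ctx.hole.fill (.var u)))) u (some (.unode m Φ')) with hσ₁def
    have h1v : σ₁ v = some (.var u) := by simp [hσ₁def, hvu, Ctx.fill]
    have h1u : σ₁ u = some (.unode m Φ') := by simp [hσ₁def]
    have h1 : ∀ w, w ≠ v → w ≠ u → σ₁ w = σ w := fun w h h' => by simp [hσ₁def, h, h']
    obtain ⟨hσ₂, hW₂⟩ := hσ₁.subst h1v hvu hvr hur rfl
    set σ₂ : EState S V := fun z => (Function.update σ₁ v none z).map (PTerm.subst u v)
      with hσ₂def
    have h2u : σ₂ u = some (.unode m (Φ'.image fun φ => (φ.1, if φ.2 = v then u else φ.2))) := by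
      simp [hσ₂def, hvu.symm, h1u, PTerm.subst]
    have h2 : ∀ w, w ≠ v → w ≠ u → σ₂ w = (σ w).map (PTerm.subst u v) := fun w h h' => by
      simp [hσ₂def, h, h1 w h h']
    have hsome : ∀ w τ', σ₂ w = some τ' → w ≠ v ∧ ∃ τ, σ₁ w = some τ ∧ τ' = τ.subst u v :=
      fun w τ' h => EState.subst_eq_some.1 h
    have hment₂ : ∀ w τ', σ₂ w = some τ' → ∀ y, τ'.Mentions y →
        y = u ∨ y ≠ v ∧ ∃ w' τ, σ w' = some τ ∧ τ.Mentions y := by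
      intro w τ' hw' y hy
      obtain ⟨-, τ, hw, rfl⟩ := hsome w τ' hw'
      obtain ⟨z, hz, rfl⟩ := hy.of_subst
      split_ifs with hzv
      · exact .inl rfl
      · exact .inr ⟨hzv, hment w τ hw z hz⟩
    -- A previous component of `u` had no trivial fragments, so all trivial ones after the merger
    -- come from `Φ`.
    have htriv : ∀ φ ∈ Φ', φ.1 = {[]} → φ ∈ Φ ∧ φ ≠ ({[]}, u) := by
      intro φ hφ hφ1
      rcases hΦ' φ hφ with h | ⟨n', Ψ, h, hΨ⟩
      · exact h
      · refine absurd ?_ (PTerm.trivialFree_unode.1 (hfree u _ h hux hvu.symm) φ.2)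
        rwa [← hφ1]
    have ht₂ : σ₂.Tidy := by
      refine ⟨fun w y hw => ?_, fun w τ' hw y hy => ?_⟩
      · obtain ⟨hwv, τ, hw, hτ⟩ := hsome w _ hw
        by_cases hwu : w = u
        · subst hwu
          rw [h1u] at hw
          cases hw
          simp [PTerm.subst] at hτ
        · rw [h1 w hwv hwu] at hw
          cases τ with
          | var z => exact ht.ne_var w z hw
          | app s τs => simp [PTerm.subst] at hτ
          | unode n Φ => simp [PTerm.subst] at hτ
      · rcases hment₂ w τ' hw y hy with rfl | ⟨hyv, w', τ, hw', hy⟩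
        · exact .inr ⟨_, _, h2u⟩
        · by_cases hyu : y = u
          · subst hyu
            exact .inr ⟨_, _, h2u⟩
          · rw [h2 y hyv hyu]
            rcases ht.mentions w' τ hw' y hy with h | ⟨n', Ψ, h⟩
            · exact .inl (by rw [h]; rfl)
            · exact .inr ⟨_, _, by rw [h]; rfl⟩
    have hx₂ : σ₂ x = (σ x).map (PTerm.subst u v) := h2 x hvx.symm hux.symm
    have hR₂ : σ₂.Rigid x := by
      constructor
      · obtain ⟨s, τs, h⟩ := hR.app
        exact ⟨_, _, by rw [hx₂, h]; rfl⟩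
      · intro w τ' hw hx
        rcases hment₂ w τ' hw x hx with h | ⟨-, w', τ, hw', hx⟩
        · exact hux h.symm
        · exact hR.not_mentions w' τ hw' hx
    -- Renaming would make a self-reference out of `({[]}, v)`, which `hvΦ` excludes.
    have g1 : (({[]} : PEC), u) ∉ Φ'.image fun φ => (φ.1, if φ.2 = v then u else φ.2) := by
      intro h
      obtain ⟨φ, hφ, h⟩ := Finset.mem_image.1 h
      simp only [Prod.mk.injEq] at h
      obtain ⟨h3, h4⟩ := htriv φ hφ h.1
      have hφeq : φ = ({[]}, φ.2) := by rw [← h.1]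
      by_cases hφv : φ.2 = v
      · rw [hφv] at hφeq
        exact hvΦ (hφeq ▸ h3)
      · rw [if_neg hφv] at h
        exact h4 (hφeq.trans (by rw [h.2]))
    have g2 : ∀ w τ, σ₂ w = some τ → w ≠ x → w ≠ u → τ.TrivialFree := by
      intro w τ' hw' hwx hwu
      obtain ⟨hwv, τ, hw, rfl⟩ := hsome w τ' hw'
      rw [h1 w hwv hwu] at hw
      exact (hfree w τ hw hwx hwv).subst _ _
    have g3 : ((Φ'.image fun φ => (φ.1, if φ.2 = v then u else φ.2)).filter fun φ => φ.1 = {[]}).card ≤ k := by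
      have hsub : (Finset.image (fun φ : PEC × V => (φ.1, if φ.2 = v then u else φ.2)) Φ').filter
          (fun φ => φ.1 = {[]}) ⊆ ((Φ.filter fun φ => φ.1 = {[]}).erase ({[]}, u)).image
            fun φ : PEC × V => (φ.1, if φ.2 = v then u else φ.2) := by
        intro ψ hψ
        obtain ⟨hψ, hψ1⟩ := Finset.mem_filter.1 hψ
        obtain ⟨φ, hφ, rfl⟩ := Finset.mem_image.1 hψ
        obtain ⟨h3, h4⟩ := htriv φ hφ hψ1
        exact Finset.mem_image_of_mem _
          (Finset.mem_erase.2 ⟨h4, Finset.mem_filter.2 ⟨h3, hψ1⟩⟩)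
      have := Finset.card_le_card hsub
      have := Finset.card_image_le (s := (Φ.filter fun φ => φ.1 = {[]}).erase ({[]}, u))
        (f := fun φ : PEC × V => (φ.1, if φ.2 = v then u else φ.2))
      have := Finset.card_erase_of_mem (a := (({[]} : PEC), u))
        (s := Φ.filter fun φ => φ.1 = {[]}) (Finset.mem_filter.2 ⟨hu, rfl⟩)
      omega
    obtain ⟨σ₃, hs₃, h3⟩ := ih hσ₂ ht₂ hR₂ h2u hur g1 g2 g3
    refine ⟨σ₃, .head hstep (.head (.subst σ₁ u v h1v) hs₃), h3.1, h3.2.1, h3.2.2.1,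
      h3.2.2.2.1, h3.2.2.2.2.1.trans (hW₂.trans hW), h3.2.2.2.2.2.trans ?_⟩
    obtain ⟨s, τs, h⟩ := hR.app
    rw [EState.weightAt_of_some h, EState.weightAt_of_some (by rw [hx₂, h]; rfl),
      PTerm.weight_subst]

/-- All trivial fragments of a component can be eliminated by suspension. -/
theorem EState.Inv.exists_drain {ρ : V → Term S} {D : Finset V} {r x : V} (k : ℕ) :
    ∀ {σ : EState S V}, σ.Inv ρ D r → σ.Tidy → σ.Rigid x → σ.weightAt ρ x ≤ k →
      (∀ w τ, σ w = some τ → w ≠ x → τ.TrivialFree) →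
      ∃ σ', Relation.ReflTransGen (Step True) σ σ' ∧ σ'.Inv ρ D r ∧ σ'.Tidy ∧
        (∀ w τ, σ' w = some τ → τ.TrivialFree) ∧ σ'.weight ρ D ≤ σ.weight ρ D := by
  classical
  induction k with
  | zero =>
    intro σ hσ ht hR hk hfree
    refine ⟨σ, .refl, hσ, ht, fun w τ hw => ?_, le_rfl⟩
    by_cases hwx : w = x
    · subst hwx
      -- Every u-node weighs at least one, so at weight zero there is none.
      intro n Φ hu
      obtain ⟨K, rfl⟩ := PTerm.exists_fill_of_mem_unodes hu
      obtain ⟨t₀, k, -, h⟩ := K.exists_hole ρ _ (hσ.compat w _ hw)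
      rw [EState.weightAt_of_some hw, (h _).2, PTerm.weight] at hk
      have := t₀.size_pos
      omega
    · exact hfree w τ hw hwx
  | succ k ih =>
    intro σ hσ ht hR hk hfree
    obtain ⟨s, τs, hx⟩ := hR.app
    by_cases hT : (PTerm.app s τs).TrivialFree
    · refine ⟨σ, .refl, hσ, ht, fun w τ hw => ?_, le_rfl⟩
      by_cases hwx : w = x
      · subst hwx
        rw [hx] at hw
        cases hw
        exact hT
      · exact hfree w τ hw hwx
    · simp only [PTerm.TrivialFree] at hT
      push Not at hT
      obtain ⟨n, Φ, hu, v, hv⟩ := hT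
      obtain ⟨K, hK⟩ := PTerm.exists_fill_of_mem_unodes hu
      rw [hK] at hx
      have hvmen : (K.fill (.unode n Φ)).Mentions v :=
        K.mentions_fill_of_mentions (PTerm.mentions_unode.2 ⟨_, hv⟩)
      have hxv : x ≠ v := by
        rintro rfl
        exact hR.not_mentions _ _ hx hvmen
      have hvr : v ≠ r := by
        rintro rfl
        exact hσ.root _ _ hx hvmen
      have hKapp : ∃ s τs, K.fill (.var v) = .app s τs := by
        rcases K.eq_hole_or_fill_app with rfl | h
        · simp [Ctx.fill] at hK
        · exact h _
      obtain ⟨m, Φ', h⟩ := hσ.exists_suspend hx hv hxv (ht.mentions _ _ hx v hvmen)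
      obtain ⟨hstep, hσ₁, hW, hwx, hΦ', hment⟩ := h _ rfl
      set σ₁ : EState S V := Function.update (Function.update σ x
        (some (K.fill (.var v)))) v (some (.unode m Φ')) with hσ₁def
      have h1v : σ₁ v = some (.unode m Φ') := by simp [hσ₁def]
      have h1x : σ₁ x = some (K.fill (.var v)) := by simp [hσ₁def, hxv]
      have h1 : ∀ w, w ≠ x → w ≠ v → σ₁ w = σ w := fun w h h' => by simp [hσ₁def, h, h']
      obtain ⟨s', τs', hKapp⟩ := hKapp
      have ht₁ : σ₁.Tidy := by
        refine ⟨fun w y hw => ?_, fun w τ hw y hy => ?_⟩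
        · by_cases hwv : w = v
          · rw [hwv, h1v] at hw
            cases hw
          · by_cases hwx : w = x
            · rw [hwx, h1x, hKapp] at hw
              cases hw
            · rw [h1 w hwx hwv] at hw
              exact ht.ne_var w y hw
        · obtain ⟨w', τ', hw', hy'⟩ := hment w τ hw y hy
          by_cases hyv : y = v
          · exact .inr ⟨m, Φ', hyv ▸ h1v⟩
          · have hyx : y ≠ x := by
              rintro rfl
              exact hR.not_mentions w' τ' hw' hy'
            rw [h1 y hyx hyv]
            exact ht.mentions w' τ' hw' y hy'
      have hR₁ : σ₁.Rigid x := by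
        refine ⟨⟨s', τs', h1x.trans (by rw [hKapp])⟩, fun w τ hw hx => ?_⟩
        obtain ⟨w', τ', hw', hx'⟩ := hment w τ hw x hx
        exact hR.not_mentions w' τ' hw' hx'
      have g1 : (({[]} : PEC), v) ∉ Φ' := by
        intro h
        rcases hΦ' _ h with ⟨-, h⟩ | ⟨n', Ψ, h, hΨ⟩
        · exact h rfl
        · exact PTerm.trivialFree_unode.1 (hfree v _ h hxv.symm) v hΨ
      have g2 : ∀ w τ, σ₁ w = some τ → w ≠ x → w ≠ v → τ.TrivialFree := by
        intro w τ hw hwx hwv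
        rw [h1 w hwx hwv] at hw
        exact hfree w τ hw hwx
      -- The suspended u-node may have carried several trivial fragments. The others now sit at `v`
      -- and are removed by unification, which keeps the lowered weight of `x`.
      obtain ⟨σ₂, hs₂, hσ₂, ht₂, hR₂, hfree₂, hW₂, hwx₂⟩ :=
        hσ₁.exists_unify _ ht₁ hR₁ h1v hvr g1 g2 le_rfl
      obtain ⟨σ₃, hs₃, hσ₃, ht₃, hfree₃, hW₃⟩ := ih hσ₂ ht₂ hR₂ (by omega) hfree₂
      exact ⟨σ₃, .head hstep (hs₂.trans hs₃), hσ₃, ht₃, hfree₃, by omega⟩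

-- Completeness: the choice dictated by the term

/-- A u-node of a solved variable can be expanded, without losing the value of the root. -/
theorem EState.Inv.exists_choose [Infinite V] {σ : EState S V} {ρ : V → Term S} {D : Finset V}
    {r : V} (hσ : σ.Inv ρ D r) (ht : σ.Tidy) (hfree : ∀ w τ, σ w = some τ → τ.TrivialFree)
    {x : V} {K : Ctx S V} {n : Node S} {Φ : Frags V} (hx : σ x = some (K.fill (.unode n Φ)))
    (hs : σ.Solved x) :
    ∃ σ' ρ' D', Step True σ σ' ∧ σ'.Inv ρ' D' r ∧ σ'.Tidy ∧ σ'.Rigid x ∧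
      (∀ w τ, σ' w = some τ → w ≠ x → τ.TrivialFree) ∧
      σ'.weight ρ' D' < σ.weight ρ D ∧ ρ' r = ρ r := by
  classical
  obtain ⟨hn, hΦ⟩ := hσ.node x _ hx n Φ (K.mem_unodes_fill_self n Φ)
  have hΦtriv : ∀ y, (({[]} : PEC), y) ∉ Φ := hfree x _ hx n Φ (K.mem_unodes_fill_self n Φ)
  have hΦm : ∀ φ ∈ Φ, (K.fill (.unode n Φ)).Mentions φ.2 := fun φ hφ =>
    K.mentions_fill_of_mentions (PTerm.mentions_unode.2 ⟨φ.1, hφ⟩)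
  obtain ⟨t₀, k, h0, hKw, hKd⟩ := K.exists_hole_forall ρ _ (hσ.compat x _ hx)
  obtain ⟨s, ts⟩ := t₀
  -- The term found at the hole selects the transition.
  obtain ⟨ch, C, hmem, hts, hC⟩ := Node.mem_den.1 h0.1
  -- There are countably many classes, so all of them can be labelled injectively in the infinite
  -- complement of `D`; global injectivity is what `Function.extend` needs below.
  obtain ⟨f, hf⟩ := exists_injective_nat PEC
  have hinf : {y | y ∉ D}.Infinite := D.finite_toSet.infinite_compl
  set w : PEC → V := fun c => (hinf.natEmbedding _ (f c) : V) with hw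
  have hwinj : Function.Injective w :=
    Subtype.val_injective.comp ((hinf.natEmbedding _).injective.comp hf)
  have hwD : ∀ c, w c ∉ D := fun c => (hinf.natEmbedding _ (f c)).2
  have : Nonempty (Term S) := ⟨.mk s ts⟩
  choose! val hval using hC
  -- The label of a class of `C` gets the common subterm at its paths.
  set ρ' : V → Term S := Function.extend w val ρ with hρ'
  have hρw : ∀ c, ρ' (w c) = val c := fun c => hwinj.extend_apply _ _ _
  have hρD : ∀ y ∈ D, ρ' y = ρ y := by
    intro y hy
    refine Function.extend_apply' _ _ _ ?_
    rintro ⟨c, rfl⟩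
    exact hwD c hy
  set Ψ : Frags V := C.image (fun c => (c, w c)) ∪ Φ with hΨ
  have hΨsat : ∀ φ ∈ Ψ, ∀ p ∈ φ.1, (Term.mk s ts).at p = some (ρ' φ.2) := by
    intro φ hφ p hp
    rw [hΨ, Finset.mem_union, Finset.mem_image] at hφ
    rcases hφ with ⟨c, hc, rfl⟩ | hφ
    · rw [hρw]
      exact hval c hc p hp
    · rw [hρD _ (hσ.mem_of_mentions hx (hΦm φ hφ))]
      exact h0.2 φ hφ p hp
  -- A satisfied class containing the empty path is trivial; `hn` excludes it for the transition and
  -- `hΦtriv` for the old fragments.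
  have hdef : ∀ φ ∈ Ψ, [] ∉ φ.1 := by
    intro φ hφ hnil
    have h1 : φ.1 = {[]} := PEC.eq_singleton_nil (hΨsat φ hφ) hnil
    rw [hΨ, Finset.mem_union, Finset.mem_image] at hφ
    rcases hφ with ⟨c, hc, rfl⟩ | hφ
    · simp only at h1
      subst h1
      exact hn s ch C (.here hmem) hc
    · exact hΦtriv φ.2 (h1 ▸ hφ)
  have hguard : ∀ φ ∈ Ψ, ∀ j p, j :: p ∈ φ.1 → j < S.arity s := by
    intro φ hφ j p hp
    exact (Term.at_cons.1 (hΨsat φ hφ _ hp)).1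
  have hstep := Step.choose σ x K _ _ hx (ChooseBox.mk (guarded := True) n Φ Ψ s ch C w hmem
    (fun c _ => hσ.fresh _ (hwD c)) hwinj.injOn hΦtriv hΨ hdef (fun _ => hguard)) hs
  set τ' : PTerm S V := .app s fun i => .unode (ch i) (Ψ.project i) with hτ'
  set σ' : EState S V := Function.update σ x (some (K.fill τ')) with hσ'
  have hcompat : ∀ z τ, σ z = some τ → τ.Denotes ρ' (ρ' z) := by
    intro z τ hz
    rw [hρD z (hσ.mem_of_some (by simp [hz]))]
    exact (hσ.compat z τ hz).congr (fun y hy => hρD y (hσ.mem_of_mem_vars hz hy))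
      fun y hy => hρD y (hσ.mem_of_mentions hz hy)
  have hxD : x ∈ D := hσ.mem_of_some (by simp [hx])
  have hτden : τ'.Denotes ρ' (.mk s ts) := by
    refine ⟨ts, rfl, fun i => ⟨hts i, fun φ hφ p hp => ?_⟩⟩
    obtain ⟨-, c, hc, hφ⟩ := Frags.mem_project.1 hφ
    rw [hφ] at hp
    exact (Term.at_cons.1 (hΨsat _ hc _ (PEC.mem_project.1 hp))).2
  have hfill : (K.fill τ').Denotes ρ' (ρ' x) := by
    have h1 := hcompat x _ hx
    rw [hρD x hxD] at h1 ⊢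
    exact hKd ρ' h1 τ' hτden
  -- The new u-nodes together miss exactly the root symbol of the expanded term.
  have hweight : (K.fill τ').weight (ρ' x) < (K.fill (.unode n Φ)).weight (ρ x) := by
    rw [hρD x hxD, hKw, hKw]
    simp only [hτ', PTerm.weight, Term.child_mk, Term.size]
    omega
  have hτm : ∀ y, τ'.Mentions y → (∃ c ∈ C, y = w c) ∨ (PTerm.unode n Φ).Mentions y := by
    intro y hy
    obtain ⟨i, hy⟩ := PTerm.mentions_app.1 hy
    obtain ⟨c, hy⟩ := PTerm.mentions_unode.1 hy
    obtain ⟨-, c', hy, -⟩ := Frags.mem_project.1 hy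
    rw [hΨ, Finset.mem_union, Finset.mem_image] at hy
    rcases hy with ⟨c'', hc, h⟩ | hy
    · cases h
      exact .inl ⟨_, hc, rfl⟩
    · exact .inr (PTerm.mentions_unode.2 ⟨c', hy⟩)
  have hment : ∀ z τ, σ' z = some τ → ∀ y, τ.Mentions y →
      (∃ c ∈ C, y = w c) ∨ ∃ z' τ', σ z' = some τ' ∧ τ'.Mentions y := by
    intro z τ hz y hy
    rcases EState.update_eq_some.1 hz with ⟨rfl, rfl⟩ | ⟨-, hz⟩
    · rcases Ctx.mentions_fill hy with hy | hy
      · exact .inr ⟨_, _, hx, hy⟩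
      · exact (hτm y hy).imp_right fun hy => ⟨_, _, hx, K.mentions_fill_of_mentions hy⟩
    · exact .inr ⟨z, τ, hz, hy⟩
  have hdom : ∀ y, σ' y = none ↔ σ y = none := by
    intro y
    by_cases hyx : y = x
    · simp [hyx, hσ', hx]
    · simp [hyx, hσ']
  have hwne : ∀ c y, σ y ≠ none → y ≠ w c := by
    rintro c y hy rfl
    exact hwD c (hσ.mem_of_some hy)
  have hclosed : ∀ x τ, σ' x = some τ → ∀ y ∈ τ.vars, σ' y ≠ none := by
    intro z τ hz y hy
    rw [Ne, hdom]
    rcases EState.update_eq_some.1 hz with ⟨rfl, rfl⟩ | ⟨-, hz⟩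
    · rcases Ctx.mem_vars_fill hy with hy | hy
      · exact hσ.closed _ _ hx y hy
      · simp [hτ', PTerm.vars] at hy
    · exact hσ.closed z τ hz y hy
  refine ⟨σ', ρ', D ∪ C.image w, hstep, ⟨?_, hclosed, ?_, EState.fresh_of_mem ?_ ?_ hclosed, ?_,
    ?_⟩, ⟨?_, ?_⟩, ⟨?_, ?_⟩, ?_, ?_, hρD r (hσ.mem_of_some hσ.root_ne)⟩
  · intro z τ hz
    rcases EState.update_eq_some.1 hz with ⟨rfl, rfl⟩ | ⟨-, hz⟩
    · exact hfill
    · exact hcompat z τ hz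
  · intro z τ hz m Φ' hu
    rcases EState.update_eq_some.1 hz with ⟨rfl, rfl⟩ | ⟨-, hz⟩
    · rcases Ctx.mem_unodes_fill hu with hu | hu
      · exact hσ.node _ _ hx m Φ' hu
      · simp only [hτ', PTerm.unodes, Set.mem_iUnion, Set.mem_singleton_iff, Prod.mk.injEq] at hu
        obtain ⟨i, rfl, rfl⟩ := hu
        exact ⟨hn.child hmem i, fun φ hφ => (Frags.mem_project.1 hφ).1⟩
    · exact hσ.node z τ hz m Φ' hu
  · intro y hy
    rw [Ne, hdom] at hy
    exact Finset.mem_union_left _ (hσ.mem_of_some hy)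
  · intro z τ hz y hy
    rcases hment z τ hz y hy with ⟨c, hc, rfl⟩ | ⟨z', τ', hz', hy⟩
    · exact Finset.mem_union_right _ (Finset.mem_image_of_mem _ hc)
    · exact Finset.mem_union_left _ (hσ.mem_of_mentions hz' hy)
  · rw [Ne, hdom]
    exact hσ.root_ne
  · intro z τ hz hy
    rcases hment z τ hz r hy with ⟨c, hc, h⟩ | ⟨z', τ', hz', hy⟩
    · exact hwne c r hσ.root_ne h
    · exact hσ.root z' τ' hz' hy
  · intro z y hz
    rcases EState.update_eq_some.1 hz with ⟨rfl, h⟩ | ⟨-, hz⟩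
    · obtain ⟨s', τs', h'⟩ := K.fill_app s fun i => .unode (ch i) (Ψ.project i)
      rw [hτ', h'] at h
      cases h
    · exact ht.ne_var z y hz
  · intro z τ hz y hy
    rcases hment z τ hz y hy with ⟨c, hc, rfl⟩ | ⟨z', τ', hz', hy⟩
    · rw [hdom]
      exact .inl (hσ.fresh _ (hwD c)).1
    · have hyx : y ≠ x := by
        rintro rfl
        exact hs (EState.mentions_iff.2 ⟨z', τ', hz', hy⟩)
      rw [hσ', Function.update_of_ne hyx]
      exact ht.mentions z' τ' hz' y hy
  · obtain ⟨s', τs', h'⟩ := K.fill_app s fun i => .unode (ch i) (Ψ.project i)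
    exact ⟨s', τs', by rw [hσ', Function.update_self, hτ', h']⟩
  · intro z τ hz hy
    rcases hment z τ hz x hy with ⟨c, hc, h⟩ | ⟨z', τ', hz', hy⟩
    · exact hwne c x (by simp [hx]) h
    · exact hs (EState.mentions_iff.2 ⟨z', τ', hz', hy⟩)
  · intro z τ hz hzx
    rcases EState.update_eq_some.1 hz with ⟨h, -⟩ | ⟨-, hz⟩
    · exact absurd h hzx
    · exact hfree z τ hz
  -- The fresh variables are unbound and weigh nothing.
  · have h1 : σ'.weight ρ' (D ∪ C.image w) = σ'.weight ρ' D := by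
      refine (Finset.sum_subset Finset.subset_union_left fun y _ hy => ?_).symm
      exact EState.weightAt_of_none ((hdom y).2 (hσ.fresh y hy).1)
    rw [h1]
    have h2 : σ'.weightAt ρ' x < σ.weightAt ρ x := by
      rw [EState.weightAt_of_some (τ := K.fill τ') (by simp [hσ']), EState.weightAt_of_some hx]
      exact hweight
    refine Finset.sum_lt_sum (fun y hy => ?_) ⟨x, hxD, h2⟩
    by_cases hyx : y = x
    · exact hyx ▸ h2.le
    · simp [EState.weightAt, hσ', hyx, hρD y hy]

-- Completeness: well-founded bindings and termination

/-- A compatible substitution belongs to the denotation when no variable is bound to a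
variable. -/
theorem EState.Inv.pden {σ : EState S V} {ρ : V → Term S} {D : Finset V} {r : V}
    (hσ : σ.Inv ρ D r) (ht : σ.Tidy) (k : ℕ) : ∀ {t : Term S}, t.size < k →
      ∀ {τ : PTerm S V}, τ.Denotes ρ t → (∀ y ∈ τ.vars, σ y ≠ none) → (∀ y, τ ≠ .var y) →
        PDen σ ρ τ t := by
  induction k with
  | zero => intro t h; omega
  | succ k ih =>
    intro t hk τ hτ hvars hne
    cases τ with
    | var y => exact absurd rfl (hne y)
    | unode n Φ => exact .unode n Φ t hτ.1 hτ.2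
    | app s τs =>
      obtain ⟨ts, rfl, h⟩ := hτ
      -- A variable is followed only below an application, where the term is already smaller, and
      -- its binding is not again a variable; so induction on size applies.
      refine .app s τs ts fun i => ?_
      have hki : (ts i).size < k := by
        have := Term.size_lt_mk s ts i
        omega
      have hvi : ∀ y ∈ (τs i).vars, σ y ≠ none := fun y hy => hvars y (Set.mem_iUnion.2 ⟨i, hy⟩)
      by_cases hi : ∃ y, τs i = .var y
      · obtain ⟨y, hy⟩ := hi
        have h' := h i
        rw [hy] at h' hvi ⊢
        have h' : ρ y = ts i := h'
        rw [← h'] at hki ⊢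
        obtain ⟨τ, hτ⟩ := Option.ne_none_iff_exists'.1 (hvi y (by simp [PTerm.vars]))
        refine .var y τ _ hτ (ih hki (hσ.compat y τ hτ) (hσ.closed y τ hτ) ?_) rfl
        rintro z rfl
        exact ht.ne_var y z hτ
      · exact ih hki (h i) hvi fun y hy => hi ⟨y, hy⟩

/-- Enumeration can be completed, without losing the value of the root. -/
theorem EState.Inv.exists_fullyEnumerated [Infinite V] {r : V} (k : ℕ) :
    ∀ {σ : EState S V} {ρ : V → Term S} {D : Finset V}, σ.Inv ρ D r → σ.Tidy →
      (∀ w τ, σ w = some τ → τ.TrivialFree) → σ.weight ρ D < k →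
      ∃ σ' ρ' D', Relation.ReflTransGen (Step True) σ σ' ∧ σ'.Inv ρ' D' r ∧ σ'.Tidy ∧
        σ'.FullyEnumerated ∧ ρ' r = ρ r := by
  classical
  induction k with
  | zero => intro σ ρ D _ _ _ h; omega
  | succ k ih =>
    intro σ ρ D hσ ht hfree hk
    by_cases hfe : σ.FullyEnumerated
    · exact ⟨σ, ρ, D, .refl, hσ, ht, hfe, rfl⟩
    have hne : (D.filter fun w => ∃ τ n Φ, σ w = some τ ∧ (n, Φ) ∈ τ.unodes ∧
        Φ ≠ ∅).Nonempty := by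
      simp only [EState.FullyEnumerated] at hfe
      push Not at hfe
      obtain ⟨w, τ, n, Φ, h1, h2, h3⟩ := hfe
      exact ⟨w, Finset.mem_filter.2 ⟨hσ.mem_of_some (by simp [h1]), τ, n, Φ, h1, h2,
        Finset.nonempty_iff_ne_empty.1 h3⟩⟩
    obtain ⟨x, hx, hmax⟩ := Finset.exists_max_image _ (fun w => (ρ w).size) hne
    obtain ⟨-, τ, n, Φ, hx, hu, -⟩ := Finset.mem_filter.1 hx
    obtain ⟨K, rfl⟩ := PTerm.exists_fill_of_mem_unodes hu
    -- A fragment at `w` mentioning `x` has a path, which is non-empty as trivial fragments are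
    -- absent. So `ρ x` would be smaller than `ρ w`, against maximality.
    have hs : σ.Solved x := by
      rintro ⟨w, τ, n', Φ', c, hw, hu', hc⟩
      have h1 : (ρ w).size ≤ (ρ x).size := hmax w (Finset.mem_filter.2
        ⟨hσ.mem_of_some (by simp [hw]), τ, n', Φ', hw, hu', Finset.ne_empty_of_mem hc⟩)
      obtain ⟨t₀, h2, h3⟩ := (hσ.compat w τ hw).exists_of_mem_unodes hu'
      obtain ⟨p, hp⟩ := (hσ.node w τ hw n' Φ' hu').2 _ hc
      have hp' : p ≠ [] := by
        rintro rfl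
        have h4 : c = {[]} := PEC.eq_singleton_nil (h3.2 _ hc) hp
        exact hfree w τ hw n' Φ' hu' x (h4 ▸ hc)
      have := Term.size_at_lt hp' (h3.2 _ hc p hp)
      simp only at this
      omega
    obtain ⟨σ₁, ρ₁, D₁, hs₁, hσ₁, ht₁, hR₁, hfree₁, hW₁, hr₁⟩ :=
      hσ.exists_choose ht hfree hx hs
    obtain ⟨σ₂, hs₂, hσ₂, ht₂, hfree₂, hW₂⟩ := hσ₁.exists_drain _ ht₁ hR₁ le_rfl hfree₁
    -- The weight dropped strictly at the choice and did not grow in the draining.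
    obtain ⟨σ₃, ρ₃, D₃, hs₃, hσ₃, ht₃, hfe₃, hr₃⟩ := ih hσ₂ ht₂ hfree₂ (by omega)
    exact ⟨σ₃, ρ₃, D₃, .head hs₁ (hs₂.trans hs₃), hσ₃, ht₃, hfe₃, hr₃.trans hr₁⟩

theorem den_subset_enumerated [Infinite V] (vtop : V) {n : Node S} (hn : n.NoTrivialPEC) :
    n.den ⊆ enumerated True vtop n := by
  classical
  intro t hT
  have key : ∀ w τ, EState.init vtop n w = some τ → w = vtop ∧ τ = .unode n ∅ := by
    intro w τ h
    rcases EState.update_eq_some.1 h with h | ⟨-, h⟩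
    · exact h
    · simp at h
  have hment : ∀ y, ¬ (PTerm.unode n (∅ : Frags V)).Mentions y := by
    simp [PTerm.mentions_unode]
  have hclosed : ∀ x τ, EState.init vtop n x = some τ → ∀ y ∈ τ.vars,
      EState.init vtop n y ≠ none := by
    intro w τ hw y hy
    obtain ⟨rfl, rfl⟩ := key w τ hw
    simp [PTerm.vars] at hy
  -- Only the root is constrained initially, so a constant substitution will do.
  have hσ : (EState.init vtop n).Inv (fun _ => t) {vtop} vtop := by
    refine ⟨?_, hclosed, ?_, EState.fresh_of_mem ?_ ?_ hclosed, by simp [EState.init], ?_⟩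
    · intro w τ hw
      obtain ⟨rfl, rfl⟩ := key w τ hw
      exact ⟨hT, by simp⟩
    · intro w τ hw m Φ hu
      obtain ⟨rfl, rfl⟩ := key w τ hw
      simp only [PTerm.unodes, Set.mem_singleton_iff, Prod.mk.injEq] at hu
      obtain ⟨rfl, rfl⟩ := hu
      exact ⟨hn, by simp⟩
    · intro y hy
      obtain ⟨τ, hy⟩ := Option.ne_none_iff_exists'.1 hy
      exact Finset.mem_singleton.2 (key y τ hy).1
    · intro w τ hw y hy
      obtain ⟨rfl, rfl⟩ := key w τ hw
      exact absurd hy (hment y)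
    · intro w τ hw
      obtain ⟨rfl, rfl⟩ := key w τ hw
      exact hment _
  have ht : (EState.init vtop n).Tidy := by
    refine ⟨fun w y hw => ?_, fun w τ hw y hy => ?_⟩
    · cases (key w _ hw).2
    · obtain ⟨rfl, rfl⟩ := key w τ hw
      exact absurd hy (hment y)
  obtain ⟨σ, ρ, D, hs, hσ', ht', hfe, hr⟩ := hσ.exists_fullyEnumerated _ ht (fun w τ hw => by
    obtain ⟨rfl, rfl⟩ := key w τ hw
    exact PTerm.trivialFree_unode.2 (by simp)) (Nat.lt_succ_self _)
  refine ⟨σ, hs, hfe, _, ⟨ρ, fun x τ hx => ?_, rfl⟩, ?_⟩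
  · refine hσ'.pden ht' _ (Nat.lt_succ_self _) (hσ'.compat x τ hx) (hσ'.closed x τ hx) ?_
    rintro y rfl
    exact ht'.ne_var x y hx
  · obtain ⟨τ, hτ⟩ := Option.ne_none_iff_exists'.1 hσ'.root_ne
    simp [hτ, hr]

end ECTA

theorem mainTheorem1 {S : ECTA.Signature.{u}} {V : Type v} [Infinite V] (vtop : V)
    (n : ECTA.Node S) (hn : n.NoTrivialPEC) :
    n.den = ECTA.enumerated True vtop n ∧
      (n.PathsInRange → n.den = ECTA.enumerated False vtop n) := by
  have h : n.den = ECTA.enumerated True vtop n :=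
    (ECTA.den_subset_enumerated vtop hn).antisymm (ECTA.enumerated_subset_den vtop n)
  exact ⟨h, fun hr => h.trans (ECTA.enumerated_unguarded vtop hr).symm⟩
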